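/- An instance of \textsc{Incomplete Connected Fair Division} (ICFD) is a tuple $(G,A,\mathcal U,p)$, where $G$ is a finite simple graph with $m$ vertices (the items), $A=\{1,\dots,n\}$ is a set of agents, $\mathcal U=\{u_i\colon V(G)\to\mathbb N_0\}_{i\in A}$ is a family of utility functions, extended additively by $u_i(X)=\sum_{v\in X}u_i(v)$ for $X\subseteq V(G)$, and $p\in\{1,\dots,m\}$. An allocation is a tuple $(\pi_1,\dots,\pi_n)$ of nonempty, pairwise disjoint sets $\pi_i\subseteq V(G)$ such that every induced subgraph $G[\pi_i]$ is connected and $|\bigcup_{i\in A}\pi_i|=p$. It is proportional if $u_i(\pi_i)\ge u_i(V(G))/n$ for every $i\in A$. The problem PROP-ICFD asks whether a given instance admits a proportional allocation. Theorem. There exists a randomized algorithm that solves PROP-ICFD in time $e^{p}\,p^{\mathcal O(p\log p)}\,m^{\mathcal O(1)}$ with success probability at least $1-\frac1e$. That is, there are a program for a random access machine with fair coin flips (unit-cost addition, truncated subtraction, comparison and indirect addressing on natural numbers) and constants $C,a,b\in\mathbb N$ such that on every instance $(G,A,\mathcal U,p)$: (i) for every outcome of the coin flips the program halts after at most $C\cdot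 e^{p}\cdot p^{\,a\,p\ln p}\cdot m^{b}$ steps; (ii) if the instance admits a proportional allocation, the program answers Yes with probability at least $1-\frac1e$; (iii) if the instance admits no proportional allocation, the program answers Yes with probability $0$. -/

import Mathlib

/-! ### The problem -/

/-- An instance `(G, A, U, p)` of Incomplete Connected Fair Division: a simple graph `G` on `m`
items, `n` agents, a utility `u i v` of every agent `i` for every item `v`, and the number
`p ∈ {1, …, m}` of items that have to be allocated. -/
structure ICFDInstance where
  /-- number of items -/
  m : ℕ
  /-- number of agents -/
  n : ℕ
  /-- number of items to allocate -/
  p : ℕ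
  one_le_p : 1 ≤ p
  p_le_m : p ≤ m
  /-- the item graph -/
  G : SimpleGraph (Fin m)
  /-- the utility functions -/
  u : Fin n → Fin m → ℕ

namespace ICFDInstance

/-- Additive valuation of a bundle. -/
def value (I : ICFDInstance) (i : Fin I.n) (X : Finset (Fin I.m)) : ℕ :=
  ∑ v ∈ X, I.u i v

/-- Allocations: pairwise disjoint, nonempty, connected bundles that use exactly `p` items. -/
structure IsAllocation (I : ICFDInstance) (π : Fin I.n → Finset (Fin I.m)) : Prop where
  nonempty : ∀ i, 1 ≤ (π i).card
  connected : ∀ i, (I.G.induce (π i : Set (Fin I.m))).Connected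
  disjoint : ∀ i j, i ≠ j → Disjoint (π i) (π j)
  card_eq : (Finset.univ.biUnion π).card = I.p

/-- Proportionality: every agent values its bundle at least at `u_i(V(G)) / n`. -/
def IsProportional (I : ICFDInstance) (π : Fin I.n → Finset (Fin I.m)) : Prop :=
  ∀ i, (I.value i Finset.univ : ℚ) / (I.n : ℚ) ≤ (I.value i (π i) : ℚ)

/-- Yes-instances of PROP-ICFD. -/
def IsYesPROP (I : ICFDInstance) : Prop :=
  ∃ π : Fin I.n → Finset (Fin I.m), I.IsAllocation π ∧ I.IsProportional π

open Classical in
/-- The instance as an input of a random access machine: the words `m`, `n`, `p`, then the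
adjacency matrix of `G` row by row, then the utilities agent by agent, then zeros. -/
noncomputable def encode (I : ICFDInstance) : ℕ → ℕ
  | 0 => I.m
  | 1 => I.n
  | 2 => I.p
  | k + 3 =>
    if h : k < I.m * I.m then
      if I.G.Adj (Fin.divNat ⟨k, h⟩) (Fin.modNat ⟨k, h⟩) then 1 else 0
    else if h : k - I.m * I.m < I.n * I.m then
      I.u (Fin.divNat ⟨k - I.m * I.m, h⟩) (Fin.modNat ⟨k - I.m * I.m, h⟩)
    else 0

end ICFDInstance

/-! ### Randomized random access machines -/

namespace RAM

/-- Programs of a random access machine with coin flips. The machine has registers, a work memory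
and a read-only input, all holding natural numbers; the last two are addressed indirectly, through
registers. The arithmetic is addition, truncated subtraction and comparison only (there is no
multiplication, so that charging one time unit per operation is a realistic measure: a number
gains at most one bit per step). -/
inductive Program where
  /-- `R[r] := k` -/
  | const (r k : ℕ)
  /-- `R[r] := R[a] + R[b]` -/
  | add (r a b : ℕ)
  /-- `R[r] := R[a] - R[b]`, or `0` if this is negative -/
  | sub (r a b : ℕ)
  /-- `R[r] := M[R[a]]` -/
  | load (r a : ℕ)
  /-- `M[R[a]] := R[b]` -/
  | store (a b : ℕ)
  /-- `R[r] := input[R[a]]` -/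
  | read (r a : ℕ)
  /-- `R[r]` becomes a fresh fair random bit -/
  | flip (r : ℕ)
  /-- first `P`, then `Q` -/
  | seq (P Q : Program)
  /-- if `R[a] < R[b]` then `P` else `Q` -/
  | ifLt (a b : ℕ) (P Q : Program)
  /-- while `R[a] < R[b]` do `P` -/
  | whileLt (a b : ℕ) (P : Program)

/-- States: contents of the registers and of the work memory, and the number of coins flipped. -/
structure State where
  reg : ℕ → ℕ
  mem : ℕ → ℕ
  coins : ℕ

/-- The state after writing `x` to register `r`. -/
def State.setReg (s : State) (r x : ℕ) : State :=
  { s with reg := Function.update s.reg r x }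

/-- The initial state: everything is zero, no coin has been flipped. -/
def State.init : State := ⟨fun _ => 0, fun _ => 0, 0⟩

/-- `Exec inp ω P s t s'`: on input `inp`, and if the outcomes of the coin flips are
`ω 0, ω 1, …`, the program `P` started in state `s` halts after exactly `t` steps in state `s'`.
Every elementary operation and every evaluation of a test is one step. -/
inductive Exec (inp : ℕ → ℕ) (ω : ℕ → Bool) : Program → State → ℕ → State → Prop where
  | const (r k : ℕ) (s : State) : Exec inp ω (.const r k) s 1 (s.setReg r k)
  | add (r a b : ℕ) (s : State) : Exec inp ω (.add r a b) s 1 (s.setReg r (s.reg a + s.reg b))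
  | sub (r a b : ℕ) (s : State) : Exec inp ω (.sub r a b) s 1 (s.setReg r (s.reg a - s.reg b))
  | load (r a : ℕ) (s : State) : Exec inp ω (.load r a) s 1 (s.setReg r (s.mem (s.reg a)))
  | store (a b : ℕ) (s : State) :
      Exec inp ω (.store a b) s 1 { s with mem := Function.update s.mem (s.reg a) (s.reg b) }
  | read (r a : ℕ) (s : State) : Exec inp ω (.read r a) s 1 (s.setReg r (inp (s.reg a)))
  | flip (r : ℕ) (s : State) :
      Exec inp ω (.flip r) s 1
        { s.setReg r (if ω s.coins then 1 else 0) with coins := s.coins + 1 }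
  | seq {P Q : Program} {s s' s'' : State} {t t' : ℕ} :
      Exec inp ω P s t s' → Exec inp ω Q s' t' s'' → Exec inp ω (.seq P Q) s (t + t') s''
  | if_true {a b : ℕ} {P Q : Program} {s s' : State} {t : ℕ} :
      s.reg a < s.reg b → Exec inp ω P s t s' → Exec inp ω (.ifLt a b P Q) s (t + 1) s'
  | if_false {a b : ℕ} {P Q : Program} {s s' : State} {t : ℕ} :
      ¬ s.reg a < s.reg b → Exec inp ω Q s t s' → Exec inp ω (.ifLt a b P Q) s (t + 1) s'
  | while_true {a b : ℕ} {P : Program} {s s' s'' : State} {t t' : ℕ} :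
      s.reg a < s.reg b → Exec inp ω P s t s' → Exec inp ω (.whileLt a b P) s' t' s'' →
      Exec inp ω (.whileLt a b P) s (t + t' + 1) s''
  | while_false {a b : ℕ} {P : Program} {s : State} :
      ¬ s.reg a < s.reg b → Exec inp ω (.whileLt a b P) s 1 s

/-- Once the coin flips are fixed, the run of a program is unique; so "the" number of steps and
"the" final state below are well defined. -/
theorem Exec.unique {inp : ℕ → ℕ} {ω : ℕ → Bool} {P : Program} {s s₁ s₂ : State} {t₁ t₂ : ℕ}
    (h₁ : Exec inp ω P s t₁ s₁) (h₂ : Exec inp ω P s t₂ s₂) : t₁ = t₂ ∧ s₁ = s₂ := by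
  induction h₁ generalizing t₂ s₂ with
  | const | add | sub | load | store | read | flip => cases h₂; exact ⟨rfl, rfl⟩
  | seq _ _ ih ih' =>
    cases h₂ with
    | seq k k' =>
      obtain ⟨rfl, rfl⟩ := ih k
      obtain ⟨rfl, rfl⟩ := ih' k'
      exact ⟨rfl, rfl⟩
  | if_true h _ ih =>
    cases h₂ with
    | if_true _ k => obtain ⟨rfl, rfl⟩ := ih k; exact ⟨rfl, rfl⟩
    | if_false h' => exact absurd h h'
  | if_false h _ ih =>
    cases h₂ with
    | if_true h' => exact absurd h' h
    | if_false _ k => obtain ⟨rfl, rfl⟩ := ih k; exact ⟨rfl, rfl⟩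
  | while_true h _ _ ih ih' =>
    cases h₂ with
    | while_true _ k k' =>
      obtain ⟨rfl, rfl⟩ := ih k
      obtain ⟨rfl, rfl⟩ := ih' k'
      exact ⟨rfl, rfl⟩
    | while_false h' => exact absurd h h'
  | while_false h =>
    cases h₂ with
    | while_true h' => exact absurd h' h
    | while_false => exact ⟨rfl, rfl⟩

/-- The run on input `inp` with coin flips `ω` halts after at most `T` steps. -/
def HaltsWithin (P : Program) (inp : ℕ → ℕ) (ω : ℕ → Bool) (T : ℝ) : Prop :=
  ∃ (t : ℕ) (s : State), Exec inp ω P State.init t s ∧ (t : ℝ) ≤ T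

/-- The run halts with answer "Yes", which is a nonzero number in register `0`. -/
def Accepts (P : Program) (inp : ℕ → ℕ) (ω : ℕ → Bool) : Prop :=
  ∃ (t : ℕ) (s : State), Exec inp ω P State.init t s ∧ s.reg 0 ≠ 0

/-- The law of an infinite sequence of independent fair coin flips. -/
noncomputable def coinMeasure : MeasureTheory.Measure (ℕ → Bool) :=
  MeasureTheory.Measure.infinitePi fun _ => (PMF.uniformOfFintype Bool).toMeasure

/-- The probability that the answer on input `inp` is "Yes". -/
noncomputable def acceptProb (P : Program) (inp : ℕ → ℕ) : ℝ :=
  coinMeasure.real {ω | Accepts P inp ω}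

end RAM

/-! ### A structured language and its compiler -/

/-! The algorithm is colour coding followed by a dynamic program. Bundles of an allocation are
connected, so the `p` allocated vertices carry a spanning forest with one tree per agent; its
vertices can be numbered by slots `0, …, p - 1`, with the roots in slots `0, …, n - 1` and every
parent before its children (`IsAllocation.exists_forest`). A round guesses a slot ("colour") for
every vertex, and a parent and an agent for every slot. For a fixed guess, the best embedding of
each tree that respects the colours is found from the last slot to the first. Different slots have
different colours, so subtrees never collide and maximise independently.

Soundness does not depend on luck: a guess that passes the check yields an embedded forest, whose
trees are the bundles of a proportional allocation (`IsTable.isYesPROP`). Conversely, for a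
yes-instance only `3 p` guesses have to be right: the colours of the `p` used vertices, `p` parents
and `p` agents (`ICFDInstance.passes_of_pattern`). Each is right with probability at least `1 / (2
p)`, so a round succeeds with probability at least `1 / N` for `N = (2 p) ^ (3 p)`. The rounds use
disjoint coins, so `N` of them all fail with probability at most `(1 - 1 / N) ^ N ≤ 1 / e`
(`le_coinMeasure_exists_samples`).

If `n > p` there is no allocation and the program rejects at once. Otherwise a round costs a
polynomial in `m`, and `N` is at most a constant times `p ^ (6 p ln p)` (`rounds_le`); the factor `e
^ p` is slack.

To run this on the machine, the algorithm is written in a small language of bounded loops. The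
compiler is proved correct together with a step bound depending only on the loop bounds
(`Ex.reaches_compile`, `Cmd.reaches_compile`). -/

namespace RAM

/-- Expressions over variables `0, 1, …`, the work memory and the input. In scope `d` the variables
below `d` are bound. `fold i init body` iterates `body` as often as variable `i` says; in `body`
variable `d` is the accumulator and variable `d + 1` the loop index. -/
inductive Ex where
  | const (k : ℕ)
  | var (i : ℕ)
  | add (a b : Ex)
  | sub (a b : Ex)
  | load (a : Ex)
  | read (a : Ex)
  | ifLt (a b x y : Ex)
  | fold (i : ℕ) (init body : Ex)

/-- `loop n f x` is `f (n - 1) (… (f 1 (f 0 x)))`. -/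
def loop {α : Type*} (n : ℕ) (f : ℕ → α → α) (x : α) : α :=
  Nat.rec x f n

@[simp] theorem loop_zero {α : Type*} (f : ℕ → α → α) (x : α) : loop 0 f x = x := rfl

theorem loop_succ {α : Type*} (n : ℕ) (f : ℕ → α → α) (x : α) :
    loop (n + 1) f x = f n (loop n f x) := rfl

open Function in
/-- The value of an expression. -/
def Ex.eval (inp mem : ℕ → ℕ) : Ex → ℕ → (ℕ → ℕ) → ℕ
  | .const k, _, _ => k
  | .var i, _, env => env i
  | .add a b, d, env => a.eval inp mem d env + b.eval inp mem d env
  | .sub a b, d, env => a.eval inp mem d env - b.eval inp mem d env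
  | .load a, d, env => mem (a.eval inp mem d env)
  | .read a, d, env => inp (a.eval inp mem d env)
  | .ifLt a b x y, d, env =>
    if a.eval inp mem d env < b.eval inp mem d env then x.eval inp mem d env
    else y.eval inp mem d env
  | .fold i init body, d, env =>
    loop (env i)
      (fun k acc => body.eval inp mem (d + 2) (update (update env d acc) (d + 1) k))
      (init.eval inp mem d env)

/-- In scope `d`, all variables are bound, and all loop bounds are variables below `q`. -/
def Ex.wf (q : ℕ) : Ex → ℕ → Bool
  | .const _, _ => true
  | .var i, d => decide (i < d)
  | .add a b, d => a.wf q d && b.wf q d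
  | .sub a b, d => a.wf q d && b.wf q d
  | .load a, d => a.wf q d
  | .read a, d => a.wf q d
  | .ifLt a b x y, d => a.wf q d && b.wf q d && x.wf q d && y.wf q d
  | .fold i init body, d => decide (i < q) && init.wf q d && body.wf q (d + 2)

/-- A bound on the number of steps, in terms of the values `B` of the loop bounds. -/
def Ex.cost (B : ℕ → ℕ) : Ex → ℕ
  | .const _ => 1
  | .var _ => 2
  | .add a b => a.cost B + b.cost B + 1
  | .sub a b => a.cost B + b.cost B + 1
  | .load a => a.cost B + 1
  | .read a => a.cost B + 1
  | .ifLt a b x y => a.cost B + b.cost B + x.cost B + y.cost B + 1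
  | .fold i init body => init.cost B + B i * (body.cost B + 5) + 6

/-- `R[r] := R[a]` -/
def Program.move (r a : ℕ) : Program :=
  .seq (.const r 0) (.add r a r)

/-- Variable `i` lives in register `2 * i`; the registers `2 * j + 1` with `S ≤ j` serve as scratch
space, and the value is delivered in register `2 * S + 1`. -/
def Ex.compile : Ex → ℕ → ℕ → Program
  | .const k, _, S => .const (2 * S + 1) k
  | .var i, _, S => .move (2 * S + 1) (2 * i)
  | .add a b, d, S =>
    .seq (a.compile d S) (.seq (b.compile d (S + 1))
      (.add (2 * S + 1) (2 * S + 1) (2 * (S + 1) + 1)))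
  | .sub a b, d, S =>
    .seq (a.compile d S) (.seq (b.compile d (S + 1))
      (.sub (2 * S + 1) (2 * S + 1) (2 * (S + 1) + 1)))
  | .load a, d, S => .seq (a.compile d S) (.load (2 * S + 1) (2 * S + 1))
  | .read a, d, S => .seq (a.compile d S) (.read (2 * S + 1) (2 * S + 1))
  | .ifLt a b x y, d, S =>
    .seq (a.compile d S) (.seq (b.compile d (S + 1))
      (.ifLt (2 * S + 1) (2 * (S + 1) + 1) (x.compile d S) (y.compile d S)))
  | .fold i init body, d, S =>
    .seq (init.compile d S) (.seq (.move (2 * d) (2 * S + 1)) (.seq (.const (2 * (d + 1)) 0)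
      (.seq
        (.whileLt (2 * (d + 1)) (2 * i)
          (.seq (body.compile (d + 2) S) (.seq (.move (2 * d) (2 * S + 1))
            (.seq (.const (2 * S + 1) 1) (.add (2 * (d + 1)) (2 * (d + 1)) (2 * S + 1))))))
        (.move (2 * S + 1) (2 * d)))))

/-- `P` halts within `T` steps, in a state that satisfies `Q`. -/
def Reaches (inp : ℕ → ℕ) (ω : ℕ → Bool) (P : Program) (s : State) (T : ℕ)
    (Q : State → Prop) : Prop :=
  ∃ t s', Exec inp ω P s t s' ∧ t ≤ T ∧ Q s'

/-! ### Proof rules for runs of bounded length. -/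

section Reaches

variable {inp : ℕ → ℕ} {ω : ℕ → Bool} {P P' : Program} {s : State} {T T' : ℕ}
  {Q Q' : State → Prop}

theorem Reaches.mono (h : Reaches inp ω P s T Q) (hT : T ≤ T') (hQ : ∀ s', Q s' → Q' s') :
    Reaches inp ω P s T' Q' := by
  obtain ⟨t, s', h, ht, hq⟩ := h
  exact ⟨t, s', h, ht.trans hT, hQ _ hq⟩

theorem Reaches.seq (h : Reaches inp ω P s T fun s' => Reaches inp ω P' s' T' Q) :
    Reaches inp ω (.seq P P') s (T + T') Q := by
  obtain ⟨t, s', h, ht, t', s'', h', ht', hq⟩ := h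
  exact ⟨_, _, .seq h h', by omega, hq⟩

theorem Reaches.const {r k : ℕ} (h : Q (s.setReg r k)) : Reaches inp ω (.const r k) s 1 Q :=
  ⟨_, _, .const r k s, le_rfl, h⟩

theorem Reaches.add {r a b : ℕ} (h : Q (s.setReg r (s.reg a + s.reg b))) :
    Reaches inp ω (.add r a b) s 1 Q :=
  ⟨_, _, .add r a b s, le_rfl, h⟩

theorem Reaches.sub {r a b : ℕ} (h : Q (s.setReg r (s.reg a - s.reg b))) :
    Reaches inp ω (.sub r a b) s 1 Q :=
  ⟨_, _, .sub r a b s, le_rfl, h⟩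

theorem Reaches.load {r a : ℕ} (h : Q (s.setReg r (s.mem (s.reg a)))) :
    Reaches inp ω (.load r a) s 1 Q :=
  ⟨_, _, .load r a s, le_rfl, h⟩

theorem Reaches.read {r a : ℕ} (h : Q (s.setReg r (inp (s.reg a)))) :
    Reaches inp ω (.read r a) s 1 Q :=
  ⟨_, _, .read r a s, le_rfl, h⟩

theorem Reaches.store {a b : ℕ}
    (h : Q { s with mem := Function.update s.mem (s.reg a) (s.reg b) }) :
    Reaches inp ω (.store a b) s 1 Q :=
  ⟨_, _, .store a b s, le_rfl, h⟩

theorem Reaches.flip {r : ℕ}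
    (h : Q { s.setReg r (if ω s.coins then 1 else 0) with coins := s.coins + 1 }) :
    Reaches inp ω (.flip r) s 1 Q :=
  ⟨_, _, .flip r s, le_rfl, h⟩

/-- The target is zeroed before the source is added to it, hence the two must differ. -/
theorem Reaches.move {r a : ℕ} (hra : r ≠ a)
    (h : ∀ s' : State, s'.mem = s.mem → s'.coins = s.coins →
      s'.reg = Function.update s.reg r (s.reg a) → Q s') :
    Reaches inp ω (.move r a) s 2 Q := by
  refine Reaches.seq (T := 1) (T' := 1) (.const (.add (h _ rfl rfl ?_)))
  simp [State.setReg, Function.update_of_ne hra.symm]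

/-- Charging both branches makes the bound independent of the test and keeps costs additive. -/
theorem Reaches.ifLt {a b : ℕ} (h₁ : s.reg a < s.reg b → Reaches inp ω P s T Q)
    (h₂ : ¬ s.reg a < s.reg b → Reaches inp ω P' s T' Q) :
    Reaches inp ω (.ifLt a b P P') s (T + T' + 1) Q := by
  by_cases h : s.reg a < s.reg b
  · obtain ⟨t, s', hx, ht, hq⟩ := h₁ h
    exact ⟨_, _, .if_true h hx, by omega, hq⟩
  · obtain ⟨t, s', hx, ht, hq⟩ := h₂ h
    exact ⟨_, _, .if_false h hx, by omega, hq⟩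

/-- The rule for counting loops with an invariant. -/
theorem Reaches.whileLt {a b N : ℕ} (Inv : ℕ → State → Prop)
    (hreg : ∀ k s, Inv k s → s.reg a = k ∧ s.reg b = N)
    (hbody : ∀ k < N, ∀ s, Inv k s → Reaches inp ω P s T (Inv (k + 1)))
    (h0 : Inv 0 s) : Reaches inp ω (.whileLt a b P) s (N * (T + 1) + 1) (Inv N) := by
  -- Induction on the number `r` of remaining iterations, since `Exec.while_true` splits off the
  -- earliest one.
  have key : ∀ r k, k + r = N → ∀ s, Inv k s →
      Reaches inp ω (.whileLt a b P) s (r * (T + 1) + 1) (Inv N) := by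
    intro r
    induction r with
    | zero =>
      intro k hk s hs
      obtain rfl : k = N := by omega
      obtain ⟨h1, h2⟩ := hreg _ _ hs
      exact ⟨_, _, .while_false (by omega), by omega, hs⟩
    | succ r ih =>
      intro k hk s hs
      obtain ⟨h1, h2⟩ := hreg _ _ hs
      obtain ⟨t, s', hx, ht, hq⟩ := hbody k (by omega) s hs
      obtain ⟨t', s'', hx', ht', hq'⟩ := ih (k + 1) (by omega) s' hq
      refine ⟨_, _, .while_true (by omega) hx hx', ?_, hq'⟩
      rw [Nat.add_mul, Nat.one_mul]
      omega
  exact key N 0 (by omega) s h0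

end Reaches

/-! ### Correctness of compiled expressions. -/

theorem State.setReg_reg (s : State) (r x : ℕ) : (s.setReg r x).reg = Function.update s.reg r x :=
  rfl

theorem State.setReg_mem (s : State) (r x : ℕ) : (s.setReg r x).mem = s.mem := rfl

theorem State.setReg_coins (s : State) (r x : ℕ) : (s.setReg r x).coins = s.coins := rfl

/-- `s'` agrees with `s` but for variables from `d` on and scratch registers from `S` on. -/
structure Frame (d S : ℕ) (s s' : State) : Prop where
  var : ∀ i < d, s'.reg (2 * i) = s.reg (2 * i)
  scratch : ∀ j < S, s'.reg (2 * j + 1) = s.reg (2 * j + 1)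

/-- What it means that a program has evaluated an expression to `x`. -/
structure Evaluated (d S x : ℕ) (s s' : State) : Prop extends Frame d S s s' where
  mem : s'.mem = s.mem
  coins : s'.coins = s.coins
  value : s'.reg (2 * S + 1) = x

theorem Evaluated.setReg {d S S' x y : ℕ} {s s' : State} (h : Evaluated d S' x s s') (hS : S ≤ S') :
    Evaluated d S y s (s'.setReg (2 * S + 1) y) where
  var i hi := by
    rw [State.setReg_reg, Function.update_of_ne (by omega), h.var i hi]
  scratch j hj := by
    rw [State.setReg_reg, Function.update_of_ne (by omega), h.scratch j (by omega)]
  mem := h.mem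
  coins := h.coins
  value := by simp [State.setReg_reg]

/-- The value is left as the current content of the register: for `S < S'` it is still `x`, for `S =
S'` it is `y`. -/
theorem Evaluated.trans {d S S' x y : ℕ} {s s' s'' : State} (h : Evaluated d S x s s')
    (h' : Evaluated d S' y s' s'') (hS : S ≤ S') :
    Evaluated d S (s''.reg (2 * S + 1)) s s'' where
  var i hi := (h'.var i hi).trans (h.var i hi)
  scratch j hj := (h'.scratch j (by omega)).trans (h.scratch j hj)
  mem := h'.mem.trans h.mem
  coins := h'.coins.trans h.coins
  value := rfl

/-- A second operand is computed in scratch space from `S + 1` on, so the first result survives in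
register `2 * S + 1`. Since `q ≤ d`, folds bind only variables outside the range of loop bounds;
hence the bounds keep the values `B` at every depth and `cost B` is valid for all iterations. -/
theorem Ex.reaches_compile (inp : ℕ → ℕ) (ω : ℕ → Bool) (q : ℕ) (B : ℕ → ℕ) (e : Ex) :
    ∀ (d S : ℕ) (env : ℕ → ℕ) (s : State), e.wf q d = true → q ≤ d →
      (∀ i < d, s.reg (2 * i) = env i) → (∀ i < q, env i = B i) →
      Reaches inp ω (e.compile d S) s (e.cost B) (Evaluated d S (e.eval inp s.mem d env) s) := by
  induction e with
  | const k =>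
    intro d S env s hw hq hs hB
    refine .const ?_
    exact Evaluated.setReg (S' := S) (x := s.reg (2 * S + 1))
      ⟨⟨fun _ _ => rfl, fun _ _ => rfl⟩, rfl, rfl, rfl⟩ le_rfl
  | var i =>
    intro d S env s hw hq hs hB
    refine .move (by omega) fun s' hm hc hr => ?_
    have hi : i < d := by simpa [Ex.wf] using hw
    refine ⟨⟨fun i hi => ?_, fun i hi => ?_⟩, hm, hc, ?_⟩
    · rw [hr, Function.update_of_ne (by omega)]
    · rw [hr, Function.update_of_ne (by omega)]
    · simp [hr, Ex.eval, hs i hi]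
  | add a b iha ihb =>
    intro d S env s hw hq hs hB
    simp only [Ex.wf, Bool.and_eq_true] at hw
    refine .mono (T := a.cost B + (b.cost B + 1)) (.seq ((iha d S env s hw.1 hq hs hB).mono le_rfl
      fun s₁ h₁ => .seq ((ihb d (S + 1) env s₁ hw.2 hq
        (fun i hi => by rw [h₁.var i hi, hs i hi]) hB).mono le_rfl fun s₂ h₂ => .add ?_)))
      (by simp only [Ex.cost]; omega) fun _ h => h
    convert (h₁.trans h₂ (by omega)).setReg le_rfl using 1
    rw [h₂.scratch S (by omega), h₁.value, h₂.value, h₁.mem]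
    rfl
  | sub a b iha ihb =>
    intro d S env s hw hq hs hB
    simp only [Ex.wf, Bool.and_eq_true] at hw
    refine .mono (T := a.cost B + (b.cost B + 1)) (.seq ((iha d S env s hw.1 hq hs hB).mono le_rfl
      fun s₁ h₁ => .seq ((ihb d (S + 1) env s₁ hw.2 hq
        (fun i hi => by rw [h₁.var i hi, hs i hi]) hB).mono le_rfl fun s₂ h₂ => .sub ?_)))
      (by simp only [Ex.cost]; omega) fun _ h => h
    convert (h₁.trans h₂ (by omega)).setReg le_rfl using 1
    rw [h₂.scratch S (by omega), h₁.value, h₂.value, h₁.mem]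
    rfl
  | load a iha =>
    intro d S env s hw hq hs hB
    refine .seq ((iha d S env s hw hq hs hB).mono le_rfl fun s₁ h₁ => .load ?_)
    convert h₁.setReg le_rfl using 1
    rw [h₁.value, h₁.mem]
    rfl
  | read a iha =>
    intro d S env s hw hq hs hB
    refine .seq ((iha d S env s hw hq hs hB).mono le_rfl fun s₁ h₁ => .read ?_)
    convert h₁.setReg le_rfl using 1
    rw [h₁.value]
    rfl
  | ifLt a b x y iha ihb ihx ihy =>
    intro d S env s hw hq hs hB
    simp only [Ex.wf, Bool.and_eq_true] at hw
    obtain ⟨⟨⟨hwa, hwb⟩, hwx⟩, hwy⟩ := hw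
    refine .mono (T := a.cost B + (b.cost B + (x.cost B + y.cost B + 1)))
      (.seq ((iha d S env s hwa hq hs hB).mono le_rfl
      fun s₁ h₁ => .seq ((ihb d (S + 1) env s₁ hwb hq
        (fun i hi => by rw [h₁.var i hi, hs i hi]) hB).mono le_rfl fun s₂ h₂ => .ifLt ?_ ?_)))
      (by simp only [Ex.cost]; omega) fun _ h => h
    all_goals
      rw [h₂.scratch S (by omega), h₁.value, h₂.value, h₁.mem]
      intro hlt
      have h₁₂ := h₁.trans h₂ (by omega)
    · refine (ihx d S env s₂ hwx hq (fun i hi => by rw [h₁₂.var i hi, hs i hi]) hB).mono le_rfl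
        fun s₃ h₃ => ?_
      convert h₁₂.trans h₃ le_rfl using 1
      rw [h₃.value, h₁₂.mem, Ex.eval, if_pos hlt]
    · refine (ihy d S env s₂ hwy hq (fun i hi => by rw [h₁₂.var i hi, hs i hi]) hB).mono le_rfl
        fun s₃ h₃ => ?_
      convert h₁₂.trans h₃ le_rfl using 1
      rw [h₃.value, h₁₂.mem, Ex.eval, if_neg hlt]
  | fold i init body ihi ihb =>
    intro d S env s hw hq hs hB
    simp only [Ex.wf, Bool.and_eq_true, decide_eq_true_eq] at hw
    obtain ⟨⟨hiq, hwi⟩, hwb⟩ := hw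
    set f : ℕ → ℕ → ℕ := fun k acc =>
      body.eval inp s.mem (d + 2) (Function.update (Function.update env d acc) (d + 1) k) with hf
    set x₀ := init.eval inp s.mem d env with hx₀
    -- The body may overwrite all scratch from `S` on, so the accumulator and the index are kept in
    -- variable registers between iterations.
    let Inv : ℕ → State → Prop := fun k s' => Frame d S s s' ∧ s'.mem = s.mem ∧
      s'.coins = s.coins ∧ s'.reg (2 * d) = loop k f x₀ ∧ s'.reg (2 * (d + 1)) = k
    refine .mono (T := init.cost B + (2 + (1 + ((B i * ((body.cost B + (2 + (1 + 1))) + 1) + 1) + 2))))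
      (.seq ((ihi d S env s hwi hq hs hB).mono le_rfl fun s₁ h₁ =>
        .seq (.move (by omega) fun s₂ hm₂ hc₂ hr₂ => .seq (.const (.seq
          ((Reaches.whileLt Inv ?_ ?_ ?_).mono le_rfl fun s₃ h₃ =>
            .move (by omega) fun s₄ hm₄ hc₄ hr₄ => ?_)))))) ?_ fun _ h => h
    · rintro k s' ⟨hfr, -, -, -, hk⟩
      exact ⟨hk, by rw [hfr.var i (by omega), hs i (by omega), hB i hiq]⟩
    · rintro k hk s' ⟨hfr, hm, hc, hacc, hk⟩
      refine .seq ((ihb (d + 2) S (Function.update (Function.update env d (loop k f x₀)) (d + 1) k)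
        s' hwb (by omega) ?_ ?_).mono le_rfl fun t₁ g₁ => .seq (.move (by omega)
          fun t₂ hm₂ hc₂ hr₂ => .seq (.const (.add ?_))))
      · intro i hi
        rcases (by omega : i < d ∨ i = d ∨ i = d + 1) with h | rfl | rfl
        · rw [Function.update_of_ne (by omega), Function.update_of_ne (by omega), hfr.var i h,
            hs i h]
        · rw [Function.update_of_ne (by omega), Function.update_self, hacc]
        · rw [Function.update_self, hk]
      · intro i hi
        rw [Function.update_of_ne (by omega), Function.update_of_ne (by omega), hB i hi]
      · refine ⟨⟨fun i hi => ?_, fun j hj => ?_⟩, ?_, ?_, ?_, ?_⟩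
        · simp only [State.setReg_reg]
          rw [Function.update_of_ne (by omega), Function.update_of_ne (by omega), hr₂,
            Function.update_of_ne (by omega), g₁.var i (by omega), hfr.var i hi]
        · simp only [State.setReg_reg]
          rw [Function.update_of_ne (by omega), Function.update_of_ne (by omega), hr₂,
            Function.update_of_ne (by omega), g₁.scratch j (by omega), hfr.scratch j hj]
        · simp only [State.setReg_mem, hm₂, g₁.mem, hm]
        · simp only [State.setReg_coins, hc₂, g₁.coins, hc]
        · simp only [State.setReg_reg]
          rw [Function.update_of_ne (by omega), Function.update_of_ne (by omega), hr₂,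
            Function.update_self, g₁.value, hm, loop_succ]
        · simp only [State.setReg_reg]
          rw [Function.update_self, Function.update_self, Function.update_of_ne (by omega), hr₂,
            Function.update_of_ne (by omega), g₁.var (d + 1) (by omega), hk]
    · refine ⟨⟨fun i hi => ?_, fun j hj => ?_⟩, ?_, ?_, ?_, ?_⟩
      · rw [State.setReg_reg, Function.update_of_ne (by omega), hr₂,
          Function.update_of_ne (by omega), h₁.var i hi]
      · rw [State.setReg_reg, Function.update_of_ne (by omega), hr₂,
          Function.update_of_ne (by omega), h₁.scratch j hj]
      · rw [State.setReg_mem, hm₂, h₁.mem]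
      · rw [State.setReg_coins, hc₂, h₁.coins]
      · rw [State.setReg_reg, Function.update_of_ne (by omega), hr₂, Function.update_self, h₁.value,
          loop_zero]
      · rw [State.setReg_reg, Function.update_self]
    · obtain ⟨hfr, hm, hc, hacc, -⟩ := h₃
      refine ⟨⟨fun i hi => ?_, fun j hj => ?_⟩, hm₄.trans hm, hc₄.trans hc, ?_⟩
      · rw [hr₄, Function.update_of_ne (by omega), hfr.var i hi]
      · rw [hr₄, Function.update_of_ne (by omega), hfr.scratch j hj]
      · rw [hr₄, Function.update_self, hacc, Ex.eval, hB i hiq]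
    · simp only [Ex.cost]
      rw [show body.cost B + (2 + (1 + 1)) + 1 = body.cost B + 5 by ring]
      omega

/-! ### Commands and the correctness of their compilation. -/

/-- Commands: `store a v` writes memory, `flip a` writes a random bit to memory, and in the body of
`loop i body`, which is executed as often as variable `i` says, variable `d` is the loop index. -/
inductive Cmd where
  | skip
  | store (a v : Ex)
  | flip (a : Ex)
  | seq (c c' : Cmd)
  | ifLt (a b : Ex) (c c' : Cmd)
  | loop (i : ℕ) (body : Cmd)

open Function in
/-- The effect of a command on the memory and the number of coins flipped. -/
def Cmd.exec (inp : ℕ → ℕ) (ω : ℕ → Bool) :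
    Cmd → ℕ → (ℕ → ℕ) → (ℕ → ℕ) × ℕ → (ℕ → ℕ) × ℕ
  | .skip, _, _, σ => σ
  | .store a v, d, env, σ =>
    (update σ.1 (a.eval inp σ.1 d env) (v.eval inp σ.1 d env), σ.2)
  | .flip a, d, env, σ =>
    (update σ.1 (a.eval inp σ.1 d env) (if ω σ.2 then 1 else 0), σ.2 + 1)
  | .seq c c', d, env, σ => c'.exec inp ω d env (c.exec inp ω d env σ)
  | .ifLt a b c c', d, env, σ =>
    if a.eval inp σ.1 d env < b.eval inp σ.1 d env then c.exec inp ω d env σ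
    else c'.exec inp ω d env σ
  | .loop i body, d, env, σ =>
    RAM.loop (env i) (fun k σ => body.exec inp ω (d + 1) (update env d k) σ) σ

/-- In scope `d`, all variables are bound, and all loop bounds are variables below `q`. -/
def Cmd.wf (q : ℕ) : Cmd → ℕ → Bool
  | .skip, _ => true
  | .store a v, d => a.wf q d && v.wf q d
  | .flip a, d => a.wf q d
  | .seq c c', d => c.wf q d && c'.wf q d
  | .ifLt a b c c', d => a.wf q d && b.wf q d && c.wf q d && c'.wf q d
  | .loop i body, d => decide (i < q) && body.wf q (d + 1)

/-- A bound on the number of steps, in terms of the values `B` of the loop bounds. -/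
def Cmd.cost (B : ℕ → ℕ) : Cmd → ℕ
  | .skip => 1
  | .store a v => a.cost B + v.cost B + 1
  | .flip a => a.cost B + 2
  | .seq c c' => c.cost B + c'.cost B
  | .ifLt a b c c' => a.cost B + b.cost B + c.cost B + c'.cost B + 1
  | .loop i body => B i * (body.cost B + 3) + 2

/-- The program of a command. -/
def Cmd.compile : Cmd → ℕ → Program
  | .skip, _ => .const 1 0
  | .store a v, d => .seq (a.compile d 0) (.seq (v.compile d 1) (.store 1 3))
  | .flip a, d => .seq (a.compile d 0) (.seq (.flip 3) (.store 1 3))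
  | .seq c c', d => .seq (c.compile d) (c'.compile d)
  | .ifLt a b c c', d =>
    .seq (a.compile d 0) (.seq (b.compile d 1) (.ifLt 1 3 (c.compile d) (c'.compile d)))
  | .loop i body, d =>
    .seq (.const (2 * d) 0) (.whileLt (2 * d) (2 * i)
      (.seq (body.compile (d + 1)) (.seq (.const 1 1) (.add (2 * d) (2 * d) 1))))

/-- What it means that a program has executed a command with effect `σ`. -/
structure Executed (d : ℕ) (σ : (ℕ → ℕ) × ℕ) (s s' : State) : Prop where
  var : ∀ i < d, s'.reg (2 * i) = s.reg (2 * i)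
  effect : (s'.mem, s'.coins) = σ

/-- No intermediate value outlives a subcommand in scratch space, so only the variables have to be
framed. -/
theorem Cmd.reaches_compile (inp : ℕ → ℕ) (ω : ℕ → Bool) (q : ℕ) (B : ℕ → ℕ) (c : Cmd) :
    ∀ (d : ℕ) (env : ℕ → ℕ) (s : State), c.wf q d = true → q ≤ d →
      (∀ i < d, s.reg (2 * i) = env i) → (∀ i < q, env i = B i) →
      Reaches inp ω (c.compile d) s (c.cost B)
        (Executed d (c.exec inp ω d env (s.mem, s.coins)) s) := by
  induction c with
  | skip =>
    intro d env s hw hq hs hB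
    refine .const ⟨fun i hi => ?_, rfl⟩
    rw [State.setReg_reg, Function.update_of_ne (by omega)]
  | store a v =>
    intro d env s hw hq hs hB
    simp only [Cmd.wf, Bool.and_eq_true] at hw
    refine .mono (T := a.cost B + (v.cost B + 1))
      (.seq ((a.reaches_compile inp ω q B d 0 env s hw.1 hq hs hB).mono le_rfl
      fun s₁ h₁ => .seq ((v.reaches_compile inp ω q B d 1 env s₁ hw.2 hq
        (fun i hi => by rw [h₁.var i hi, hs i hi]) hB).mono le_rfl fun s₂ h₂ => .store ?_)))
      (by simp only [Cmd.cost]; omega) fun _ h => h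
    refine ⟨fun i hi => (h₂.var i hi).trans (h₁.var i hi), ?_⟩
    have e₁ : s₂.reg 1 = _ := (h₂.scratch 0 (by omega)).trans h₁.value
    have e₂ : s₂.reg 3 = _ := h₂.value
    simp only [Cmd.exec, e₁, e₂, h₂.mem, h₁.mem, h₂.coins, h₁.coins]
  | flip a =>
    intro d env s hw hq hs hB
    refine .mono (T := a.cost B + (1 + 1))
      (.seq ((a.reaches_compile inp ω q B d 0 env s hw hq hs hB).mono le_rfl
      fun s₁ h₁ => .seq (.flip (.store ?_))))
      (by simp only [Cmd.cost]; omega) fun _ h => h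
    refine ⟨fun i hi => ?_, ?_⟩
    · simp only [State.setReg_reg]
      rw [Function.update_of_ne (by omega), h₁.var i hi]
    · have e₁ : s₁.reg 1 = _ := h₁.value
      simp [Cmd.exec, State.setReg, e₁, h₁.mem, h₁.coins]
  | seq c c' ih ih' =>
    intro d env s hw hq hs hB
    simp only [Cmd.wf, Bool.and_eq_true] at hw
    refine .seq ((ih d env s hw.1 hq hs hB).mono le_rfl fun s₁ h₁ =>
      (ih' d env s₁ hw.2 hq (fun i hi => by rw [h₁.var i hi, hs i hi]) hB).mono le_rfl
        fun s₂ h₂ => ⟨fun i hi => (h₂.var i hi).trans (h₁.var i hi), ?_⟩)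
    rw [h₂.effect, h₁.effect, Cmd.exec]
  | ifLt a b c c' ih ih' =>
    intro d env s hw hq hs hB
    simp only [Cmd.wf, Bool.and_eq_true] at hw
    obtain ⟨⟨⟨hwa, hwb⟩, hwx⟩, hwy⟩ := hw
    refine .mono (T := a.cost B + (b.cost B + (c.cost B + c'.cost B + 1)))
      (.seq ((a.reaches_compile inp ω q B d 0 env s hwa hq hs hB).mono le_rfl
      fun s₁ h₁ => .seq ((b.reaches_compile inp ω q B d 1 env s₁ hwb hq
        (fun i hi => by rw [h₁.var i hi, hs i hi]) hB).mono le_rfl fun s₂ h₂ => .ifLt ?_ ?_)))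
      (by simp only [Cmd.cost]; omega) fun _ h => h
    all_goals
      have e₁ : s₂.reg 1 = _ := (h₂.scratch 0 (by omega)).trans h₁.value
      have e₂ : s₂.reg 3 = _ := h₂.value
      rw [e₁, e₂, h₁.mem]
      intro hlt
      have hv : ∀ i < d, s₂.reg (2 * i) = s.reg (2 * i) :=
        fun i hi => (h₂.var i hi).trans (h₁.var i hi)
      have hmc : (s₂.mem, s₂.coins) = (s.mem, s.coins) := by
        rw [h₂.mem, h₁.mem, h₂.coins, h₁.coins]
    · refine (ih d env s₂ hwx hq (fun i hi => by rw [hv i hi, hs i hi]) hB).mono le_rfl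
        fun s₃ h₃ => ⟨fun i hi => (h₃.var i hi).trans (hv i hi), ?_⟩
      rw [h₃.effect, hmc, Cmd.exec, if_pos hlt]
    · refine (ih' d env s₂ hwy hq (fun i hi => by rw [hv i hi, hs i hi]) hB).mono le_rfl
        fun s₃ h₃ => ⟨fun i hi => (h₃.var i hi).trans (hv i hi), ?_⟩
      rw [h₃.effect, hmc, Cmd.exec, if_neg hlt]
  | loop i body ih =>
    intro d env s hw hq hs hB
    simp only [Cmd.wf, Bool.and_eq_true, decide_eq_true_eq] at hw
    obtain ⟨hiq, hwb⟩ := hw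
    let Inv : ℕ → State → Prop := fun k s' => Executed d (RAM.loop k
      (fun k σ => body.exec inp ω (d + 1) (Function.update env d k) σ) (s.mem, s.coins)) s s' ∧
      s'.reg (2 * d) = k
    refine .mono (T := 1 + (B i * ((body.cost B + (1 + 1)) + 1) + 1))
      (.seq (.const ((Reaches.whileLt Inv ?_ ?_ ?_).mono le_rfl fun s₁ h₁ => ?_))) ?_ fun _ h => h
    · rintro k s' ⟨hx, hk⟩
      exact ⟨hk, by rw [hx.var i (by omega), hs i (by omega), hB i hiq]⟩
    · rintro k hk s' ⟨hx, hk⟩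
      refine .seq ((ih (d + 1) (Function.update env d k) s' hwb (by omega) ?_ ?_).mono le_rfl
        fun t₁ g₁ => .seq (.const (.add ?_)))
      · intro i hi
        rcases (by omega : i < d ∨ i = d) with h | rfl
        · rw [Function.update_of_ne (by omega), hx.var i h, hs i h]
        · rw [Function.update_self, hk]
      · intro i hi
        rw [Function.update_of_ne (by omega), hB i hi]
      · refine ⟨⟨fun i hi => ?_, ?_⟩, ?_⟩
        · simp only [State.setReg_reg]
          rw [Function.update_of_ne (by omega), Function.update_of_ne (by omega),
            g₁.var i (by omega), hx.var i hi]
        · simp only [State.setReg_mem, State.setReg_coins]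
          rw [g₁.effect, hx.effect, loop_succ]
        · simp only [State.setReg_reg]
          rw [Function.update_self, Function.update_self, Function.update_of_ne (by omega),
            g₁.var d (by omega), hk]
    · refine ⟨⟨fun i hi => ?_, rfl⟩, ?_⟩
      · rw [State.setReg_reg, Function.update_of_ne (by omega)]
      · rw [State.setReg_reg, Function.update_self]
    · refine ⟨h₁.1.var, ?_⟩
      rw [h₁.1.effect, Cmd.exec, hB i hiq]
    · simp only [Cmd.cost]
      rw [show body.cost B + (1 + 1) + 1 = body.cost B + 3 by ring]
      omega

end RAM

/-! ### Forests of slots and colour tables -/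

/-- The slots `0, …, p - 1` form a forest: slot `i < n` is the root of the tree of agent `i`, and
any other slot has an earlier parent that belongs to the same agent. -/
structure IsForest (n p : ℕ) (par ag : ℕ → ℕ) : Prop where
  root : ∀ i < n, ag i = i
  par_lt : ∀ j, n ≤ j → j < p → par j < j
  ag_par : ∀ j, n ≤ j → j < p → ag (par j) = ag j

/-- The children of a slot. -/
def children (n p : ℕ) (par : ℕ → ℕ) (c : ℕ) : Finset ℕ :=
  (Finset.range p).filter fun k => n ≤ k ∧ par k = c

theorem mem_children {n p : ℕ} {par : ℕ → ℕ} {c k : ℕ} :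
    k ∈ children n p par c ↔ k < p ∧ n ≤ k ∧ par k = c := by
  simp [children]

/-- The slots of an agent. -/
def slots (p : ℕ) (ag : ℕ → ℕ) (i : ℕ) : Finset ℕ :=
  (Finset.range p).filter fun k => ag k = i

theorem mem_slots {p : ℕ} {ag : ℕ → ℕ} {i k : ℕ} : k ∈ slots p ag i ↔ k < p ∧ ag k = i := by
  simp [slots]

namespace IsForest

variable {n p : ℕ} {par ag : ℕ → ℕ}

theorem ag_lt (h : IsForest n p par ag) (j : ℕ) (hj : j < p) : ag j < n := by
  induction j using Nat.strong_induction_on with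
  | _ j ih =>
    by_cases hn : j < n
    · rwa [h.root j hn]
    · have := h.par_lt j (by omega) hj
      rw [← h.ag_par j (by omega) hj]
      exact ih _ this (by omega)

/-- Each slot of agent `i` other than its root is the child of exactly one slot, again of agent `i`.
This makes the table recursion telescope when it is summed over a tree. -/
theorem sum_slots (h : IsForest n p par ag) (hnp : n ≤ p) {i : ℕ} (hi : i < n) (g : ℕ → ℕ) :
    ∑ j ∈ slots p ag i, g j = g i + ∑ j ∈ slots p ag i, ∑ k ∈ children n p par j, g k := by
  have h₁ : ∑ j ∈ slots p ag i, ∑ k ∈ children n p par j, g k =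
      ∑ k ∈ (slots p ag i).filter (n ≤ ·), g k := by
    rw [← Finset.sum_fiberwise_of_maps_to (s := (slots p ag i).filter (n ≤ ·))
      (t := slots p ag i) (g := par)]
    · refine Finset.sum_congr rfl fun j hj => Finset.sum_congr ?_ fun _ _ => rfl
      ext k
      rw [mem_slots] at hj
      simp only [mem_children, Finset.mem_filter, mem_slots]
      constructor
      · rintro ⟨h1, h2, h3⟩
        exact ⟨⟨⟨h1, by rw [← h.ag_par k h2 h1, h3, hj.2]⟩, h2⟩, h3⟩
      · rintro ⟨⟨⟨h1, -⟩, h2⟩, h3⟩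
        exact ⟨h1, h2, h3⟩
    · intro k hk
      simp only [Finset.mem_filter, mem_slots] at hk
      have := h.par_lt k hk.2 hk.1.1
      exact mem_slots.2 ⟨by omega, by rw [h.ag_par k hk.2 hk.1.1, hk.1.2]⟩
  have h₂ : (slots p ag i).filter (¬ n ≤ ·) = {i} := by
    ext k
    simp only [Finset.mem_filter, mem_slots, Finset.mem_singleton]
    constructor
    · rintro ⟨⟨-, h2⟩, h3⟩
      rwa [h.root k (by omega)] at h2
    · rintro rfl
      exact ⟨⟨by omega, h.root k hi⟩, by omega⟩
  rw [h₁, ← Finset.sum_filter_add_sum_filter_not (slots p ag i) (n ≤ ·), h₂,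
    Finset.sum_singleton, add_comm]

end IsForest

/-! ### Tables and the embeddings that they certify. -/

namespace ICFDInstance

/-- `g` picks neighbours of `v` for the children of the slot of `v`, all with a positive entry in
the table `W`. -/
def IsChoice (I : ICFDInstance) (col : Fin I.m → ℕ) (par : ℕ → ℕ) (W : Fin I.m → ℕ)
    (v : Fin I.m) (g : ℕ → Fin I.m) : Prop :=
  ∀ k ∈ children I.n I.p par (col v), I.G.Adj v (g k) ∧ col (g k) = k ∧ 0 < W (g k)

/-- `W v` is zero if the subtree of the slot `col v` cannot be embedded with `v` at its root and all
slots at vertices of their own colour; otherwise it is one plus the largest total utility of such an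
embedding. -/
structure IsTable (I : ICFDInstance) (col : Fin I.m → ℕ) (par ag : ℕ → ℕ)
    (u : ℕ → Fin I.m → ℕ) (W : Fin I.m → ℕ) : Prop where
  attained : ∀ v, col v < I.p → 0 < W v → ∃ g, I.IsChoice col par W v g ∧
    W v ≤ 1 + u (ag (col v)) v + ∑ k ∈ children I.n I.p par (col v), (W (g k) - 1)
  upper : ∀ v, col v < I.p → ∀ g, I.IsChoice col par W v g →
    1 + u (ag (col v)) v + ∑ k ∈ children I.n I.p par (col v), (W (g k) - 1) ≤ W v

/-- Walking down from the roots, each slot takes the vertex that a maximising choice at its parent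
picks for it; positivity of the entries is inherited, so the walk never gets stuck. -/
theorem IsTable.exists_embedding {I : ICFDInstance} {col : Fin I.m → ℕ} {par ag : ℕ → ℕ}
    {u : ℕ → Fin I.m → ℕ} {W : Fin I.m → ℕ} (hW : I.IsTable col par ag u W)
    (hF : IsForest I.n I.p par ag) (root : ℕ → Fin I.m)
    (hroot : ∀ i < I.n, col (root i) = i ∧ 0 < W (root i)) :
    ∃ f : ℕ → Fin I.m, (∀ i < I.n, f i = root i) ∧
      (∀ j < I.p, W (f j) ≤ 1 + u (ag j) (f j) +
        ∑ k ∈ children I.n I.p par j, (W (f k) - 1)) ∧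
      ∀ j < I.p, col (f j) = j ∧ 0 < W (f j) ∧ (I.n ≤ j → I.G.Adj (f (par j)) (f j)) := by
  have hg : ∀ v, ∃ g, col v < I.p → 0 < W v → I.IsChoice col par W v g ∧
      W v ≤ 1 + u (ag (col v)) v + ∑ k ∈ children I.n I.p par (col v), (W (g k) - 1) := by
    intro v
    by_cases h : col v < I.p ∧ 0 < W v
    · obtain ⟨g, hg⟩ := hW.attained v h.1 h.2
      exact ⟨g, fun _ _ => hg⟩
    · exact ⟨fun _ => v, fun h1 h2 => absurd ⟨h1, h2⟩ h⟩
  choose g hg using hg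
  -- Parents precede children, so assigning slot `J` last disturbs no equation that is already
  -- established.
  have key : ∀ J ≤ I.p, ∃ f : ℕ → Fin I.m, (∀ i < I.n, f i = root i) ∧
      (∀ j < J, I.n ≤ j → f j = g (f (par j)) j) := by
    intro J
    induction J with
    | zero => exact fun _ => ⟨root, fun _ _ => rfl, fun j hj => absurd hj (by omega)⟩
    | succ J ih =>
      intro hJ
      obtain ⟨f, h1, h2⟩ := ih (by omega)
      by_cases hn : J < I.n
      · exact ⟨f, h1, fun j hj hnj => absurd hj (by omega)⟩
      · refine ⟨Function.update f J (g (f (par J)) J), fun i hi => ?_, fun j hj hnj => ?_⟩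
        · rw [Function.update_of_ne (by omega), h1 i hi]
        · have hp := hF.par_lt j hnj (by omega)
          rw [Function.update_of_ne (a := par j) (by omega)]
          rcases (by omega : j = J ∨ j < J) with rfl | hlt
          · rw [Function.update_self]
          · rw [Function.update_of_ne (by omega), h2 j hlt hnj]
  obtain ⟨f, h1, h2⟩ := key I.p le_rfl
  have h3 : ∀ j < I.p, col (f j) = j ∧ 0 < W (f j) ∧ (I.n ≤ j → I.G.Adj (f (par j)) (f j)) := by
    intro j
    induction j using Nat.strong_induction_on with
    | _ j ih =>
      intro hj
      by_cases hn : j < I.n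
      · rw [h1 j hn]
        exact ⟨(hroot j hn).1, (hroot j hn).2, fun h => absurd h (by omega)⟩
      · have hp := hF.par_lt j (by omega) hj
        obtain ⟨c1, c2, -⟩ := ih _ hp (by omega)
        obtain ⟨a1, a2, a3⟩ := (hg (f (par j)) (by omega) c2).1 j
          (mem_children.2 ⟨hj, by omega, by omega⟩)
        rw [h2 j hj (by omega)]
        exact ⟨a2, a3, fun _ => a1⟩
  refine ⟨f, h1, fun j hj => ?_, h3⟩
  obtain ⟨c1, c2, -⟩ := h3 j hj
  have := (hg (f j) (by omega) c2).2
  rw [c1] at this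
  refine this.trans (le_of_eq ?_)
  congr 1
  refine Finset.sum_congr rfl fun k hk => ?_
  rw [mem_children] at hk
  rw [h2 k hk.1 hk.2.1, hk.2.2]

/-- A table with large entries at the roots proves that there is a proportional allocation. -/
theorem IsTable.isYesPROP {I : ICFDInstance} {col : Fin I.m → ℕ} {par ag : ℕ → ℕ}
    {u : ℕ → Fin I.m → ℕ} {W : Fin I.m → ℕ} (hW : I.IsTable col par ag u W)
    (hF : IsForest I.n I.p par ag) (hnp : I.n ≤ I.p) (hu : ∀ i : Fin I.n, u i = I.u i)
    (hroot : ∀ i : Fin I.n, ∃ w, col w = i ∧ I.value i Finset.univ + I.n ≤ I.n * W w) :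
    I.IsYesPROP := by
  classical
  choose r hr using hroot
  let root : ℕ → Fin I.m := fun i =>
    if h : i < I.n then r ⟨i, h⟩ else ⟨0, I.one_le_p.trans I.p_le_m⟩
  have hroot : ∀ i : Fin I.n, root i = r i := fun i => by simp [root]
  -- The summand `I.n` in the threshold excludes infeasible roots: `W = 0` would force `I.n = 0`.
  have hpos : ∀ i : Fin I.n, 0 < W (r i) := fun i => by
    have h1 := (hr i).2
    have h2 := i.pos
    rcases Nat.eq_zero_or_pos (W (r i)) with h0 | h0
    · rw [h0] at h1; omega
    · exact h0
  obtain ⟨f, hf1, hf2, hf3⟩ := hW.exists_embedding hF root fun i hi =>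
    ⟨by rw [hroot ⟨i, hi⟩, (hr _).1], by rw [hroot ⟨i, hi⟩]; exact hpos _⟩
  -- The colour of a vertex recovers its slot; disjointness and the count `p` both come from this.
  have hinj : ∀ j < I.p, ∀ k < I.p, f j = f k → j = k := fun j hj k hk h => by
    rw [← (hf3 j hj).1, ← (hf3 k hk).1, h]
  let π : Fin I.n → Finset (Fin I.m) := fun i => (slots I.p ag i).image f
  have hmem : ∀ i v, v ∈ π i ↔ ∃ j, (j < I.p ∧ ag j = i) ∧ f j = v := fun i v => by
    simp [π, mem_slots]
  have hself : ∀ i : Fin I.n, f i ∈ π i := fun i =>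
    (hmem _ _).2 ⟨i, ⟨i.2.trans_le hnp, hF.root i i.2⟩, rfl⟩
  refine ⟨π, ⟨fun i => Finset.card_pos.2 ⟨_, hself i⟩, fun i => ?_, fun i j hij => ?_, ?_⟩,
    fun i => ?_⟩
  · rw [SimpleGraph.connected_iff_exists_forall_reachable]
    refine ⟨⟨f i, hself i⟩, ?_⟩
    rintro ⟨v, hv⟩
    obtain ⟨j, ⟨hj, hji⟩, rfl⟩ := (hmem _ _).1 hv
    induction j using Nat.strong_induction_on with
    | _ j ih =>
      by_cases hn : j < I.n
      · rw [hF.root j hn] at hji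
        subst hji
        exact .refl _
      · have hp := hF.par_lt j (by omega) hj
        have ha := (hF.ag_par j (by omega) hj).trans hji
        have hv' : f (par j) ∈ π i := (hmem _ _).2 ⟨_, ⟨by omega, ha⟩, rfl⟩
        refine (ih (par j) hp (by omega) ha hv').trans (SimpleGraph.Adj.reachable ?_)
        exact (hf3 j hj).2.2 (by omega)
  · rw [Finset.disjoint_left]
    intro v hv hv'
    obtain ⟨a, ⟨ha, hai⟩, rfl⟩ := (hmem _ _).1 hv
    obtain ⟨b, ⟨hb, hbi⟩, hab⟩ := (hmem _ _).1 hv'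
    obtain rfl := hinj b hb a ha hab
    exact hij (Fin.ext (hai.symm.trans hbi))
  · have : Finset.univ.biUnion π = (Finset.range I.p).image f := by
      ext v
      simp only [Finset.mem_biUnion, Finset.mem_univ, true_and, hmem, Finset.mem_image,
        Finset.mem_range]
      constructor
      · rintro ⟨i, j, ⟨hj, -⟩, h⟩
        exact ⟨j, hj, h⟩
      · rintro ⟨j, hj, h⟩
        exact ⟨⟨ag j, hF.ag_lt j hj⟩, j, ⟨hj, rfl⟩, h⟩
    rw [this, Finset.card_image_of_injOn, Finset.card_range]
    intro j hj k hk h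
    exact hinj j (by simpa using hj) k (by simpa using hk) h
  · have hval : I.value i (π i) = ∑ j ∈ slots I.p ag i, I.u i (f j) := by
      refine Finset.sum_image fun j hj k hk h => ?_
      exact hinj j (mem_slots.1 hj).1 k (mem_slots.1 hk).1 h
    -- Summing the recursion over the slots of `i` cancels every term but the one of the root.
    have hle : W (r i) ≤ 1 + I.value i (π i) := by
      have h1 := hF.sum_slots hnp i.2 fun j => W (f j) - 1
      have h2 : ∑ j ∈ slots I.p ag i, (W (f j) - 1) ≤ ∑ j ∈ slots I.p ag i, (I.u i (f j) +
          ∑ k ∈ children I.n I.p par j, (W (f k) - 1)) := by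
        refine Finset.sum_le_sum fun j hj => ?_
        rw [mem_slots] at hj
        have := hf2 j hj.1
        rw [hj.2, hu i] at this
        omega
      rw [Finset.sum_add_distrib, ← hval, h1, hf1 i i.2, hroot] at h2
      simp only at h2
      omega
    have hn : (0 : ℚ) < I.n := by exact_mod_cast i.pos
    rw [div_le_iff₀ hn]
    have h3 : I.value i Finset.univ ≤ I.value i (π i) * I.n := by
      have := (hr i).2.trans (Nat.mul_le_mul_left I.n hle)
      rw [Nat.mul_add] at this
      rw [Nat.mul_comm]
      omega
    exact_mod_cast h3

/-- If a forest of slots is embedded in vertices of the right colours, then the table has large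
entries at the roots. -/
theorem IsTable.sum_le {I : ICFDInstance} {col : Fin I.m → ℕ} {par ag : ℕ → ℕ}
    {u : ℕ → Fin I.m → ℕ} {W : Fin I.m → ℕ} (hW : I.IsTable col par ag u W)
    (hF : IsForest I.n I.p par ag) (hnp : I.n ≤ I.p) (f : ℕ → Fin I.m)
    (hcol : ∀ j < I.p, col (f j) = j)
    (hadj : ∀ j, I.n ≤ j → j < I.p → I.G.Adj (f (par j)) (f j)) (i : ℕ) (hi : i < I.n) :
    1 + ∑ j ∈ slots I.p ag i, u i (f j) ≤ W (f i) := by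
  have hstep : ∀ j < I.p, (∀ k ∈ children I.n I.p par j, 0 < W (f k)) →
      1 + u (ag j) (f j) + ∑ k ∈ children I.n I.p par j, (W (f k) - 1) ≤ W (f j) := by
    intro j hj hpos
    have := hW.upper (f j) (by rwa [hcol j hj]) f fun k hk => by
      rw [hcol j hj] at hk
      have hk' := mem_children.1 hk
      refine ⟨?_, hcol k hk'.1, hpos k hk⟩
      have := hadj k hk'.2.1 hk'.1
      rwa [hk'.2.2] at this
    rwa [hcol j hj] at this
  -- Here `r` counts the slots after `j`: children have larger numbers, so the induction runs from
  -- the last slot down.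
  have hpos : ∀ r j, j + r + 1 = I.p → 0 < W (f j) := by
    intro r
    induction r using Nat.strong_induction_on with
    | _ r ih =>
      intro j hj
      have := hstep j (by omega) fun k hk => by
        have hk' := mem_children.1 hk
        have := hF.par_lt k hk'.2.1 hk'.1
        exact ih (I.p - k - 1) (by omega) k (by omega)
      omega
  have hpos' : ∀ j < I.p, 0 < W (f j) := fun j hj => hpos (I.p - j - 1) j (by omega)
  have h1 := hF.sum_slots hnp hi fun j => W (f j) - 1
  have h2 : ∑ j ∈ slots I.p ag i, (u i (f j) + ∑ k ∈ children I.n I.p par j, (W (f k) - 1)) ≤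
      ∑ j ∈ slots I.p ag i, (W (f j) - 1) := by
    refine Finset.sum_le_sum fun j hj => ?_
    rw [mem_slots] at hj
    have := hstep j hj.1 fun k hk => hpos' k (mem_children.1 hk).1
    rw [hj.2] at this
    omega
  rw [Finset.sum_add_distrib, h1] at h2
  have := hpos' i (by omega)
  simp only at h2
  omega

/-! ### From allocations to forests of slots. -/

theorem IsAllocation.n_le_p {I : ICFDInstance} {π : Fin I.n → Finset (Fin I.m)}
    (h : I.IsAllocation π) : I.n ≤ I.p := by
  rw [← h.card_eq, Finset.card_biUnion fun i _ j _ => h.disjoint i j]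
  calc I.n = ∑ _i : Fin I.n, 1 := by simp
    _ ≤ _ := Finset.sum_le_sum fun i _ => h.nonempty i

/-- The forest grows by one vertex at a time: while fewer than `p` vertices are used, some bundle
has an unused vertex, and a walk to it from the root of that bundle crosses from used to unused. The
bound on `par` includes the roots, whose parents are irrelevant but are sampled as well. -/
theorem IsAllocation.exists_partial_forest {I : ICFDInstance} {π : Fin I.n → Finset (Fin I.m)}
    (h : I.IsAllocation π) (J : ℕ) (hnJ : I.n ≤ J) (hJ : J ≤ I.p) :
    ∃ (f : ℕ → Fin I.m) (par ag : ℕ → ℕ), IsForest I.n J par ag ∧ (∀ j < J, par j < J) ∧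
      Set.InjOn f (Set.Iio J) ∧ (∀ j, I.n ≤ j → j < J → I.G.Adj (f (par j)) (f j)) ∧
      ∀ j < J, ∃ hj : ag j < I.n, f j ∈ π ⟨ag j, hj⟩ := by
  classical
  induction J, hnJ using Nat.le_induction with
  | base =>
    have hne : ∀ i, ∃ v, v ∈ π i := fun i => Finset.card_pos.1 (h.nonempty i)
    choose r hr using hne
    refine ⟨fun i => if hi : i < I.n then r ⟨i, hi⟩ else ⟨0, I.one_le_p.trans I.p_le_m⟩,
      fun _ => 0, id, ⟨fun _ _ => rfl, fun j h1 h2 => absurd h1 (by omega),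
      fun j h1 h2 => absurd h1 (by omega)⟩, fun j hj => Nat.zero_lt_of_lt hj, ?_,
      fun j h1 h2 => absurd h1 (by omega), ?_⟩
    · intro a (ha : a < I.n) b (hb : b < I.n) hab
      simp only [ha, hb, dif_pos] at hab
      by_contra hne
      have := h.disjoint ⟨a, ha⟩ ⟨b, hb⟩ (by simpa using hne)
      rw [Finset.disjoint_left] at this
      exact this (hr _) (hab ▸ hr _)
    · intro j hj
      refine ⟨hj, ?_⟩
      simp only [hj, dif_pos]
      exact hr _
  | succ J hnJ ih =>
    obtain ⟨f, par, ag, hF, hpar, hinj, hadj, hmem⟩ := ih (by omega)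
    have hcard : ((Finset.range J).image f).card < (Finset.univ.biUnion π).card := by
      rw [h.card_eq]
      have := Finset.card_image_le (s := Finset.range J) (f := f)
      rw [Finset.card_range] at this
      omega
    obtain ⟨v, hv, hvf⟩ := Finset.exists_mem_notMem_of_card_lt_card hcard
    obtain ⟨i, -, hvi⟩ := Finset.mem_biUnion.1 hv
    have hfi : f i ∈ π i := by
      obtain ⟨h1, h2⟩ := hmem i (i.2.trans_le hnJ)
      have h3 : (⟨ag i, h1⟩ : Fin I.n) = i := Fin.ext (hF.root i i.2)
      rwa [h3] at h2
    obtain ⟨w⟩ := (h.connected i).preconnected ⟨f i, hfi⟩ ⟨v, hvi⟩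
    obtain ⟨d, -, hd1, hd2⟩ := w.exists_boundary_dart
      {x | x.1 ∈ (Finset.range J).image f}
      (show f i ∈ (Finset.range J).image f from
        Finset.mem_image_of_mem f (Finset.mem_range.2 (i.2.trans_le hnJ))) hvf
    rw [Set.mem_ofPred_eq] at hd1 hd2
    obtain ⟨a, ha, hax⟩ := Finset.mem_image.1 hd1
    rw [Finset.mem_range] at ha
    have had : I.G.Adj d.fst.1 d.snd.1 := d.adj
    -- The edge lies inside bundle `i`, and bundles are disjoint, so its used end belongs to agent
    -- `i`.
    have haga : ag a = i := by
      obtain ⟨h1, h2⟩ := hmem a ha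
      by_contra hne
      have := h.disjoint ⟨ag a, h1⟩ i (fun h => hne (congrArg Fin.val h))
      rw [Finset.disjoint_left] at this
      exact this h2 (hax ▸ d.fst.2)
    have hnew : ∀ j < J, f j ≠ d.snd.1 := fun j hj he =>
      hd2 (Finset.mem_image.2 ⟨j, Finset.mem_range.2 hj, he⟩)
    refine ⟨Function.update f J d.snd.1, Function.update par J a, Function.update ag J i,
      ⟨?_, ?_, ?_⟩, ?_, ?_, ?_, ?_⟩
    · intro j hj
      rw [Function.update_of_ne (by omega), hF.root j hj]
    · intro j h1 h2
      rcases (by omega : j = J ∨ j < J) with rfl | hlt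
      · rwa [Function.update_self]
      · rw [Function.update_of_ne (by omega)]
        exact hF.par_lt j h1 hlt
    · intro j h1 h2
      rcases (by omega : j = J ∨ j < J) with rfl | hlt
      · rw [Function.update_self, Function.update_self, Function.update_of_ne (by omega), haga]
      · have := hF.par_lt j h1 hlt
        rw [Function.update_of_ne (a := j) (by omega), Function.update_of_ne (a := j) (by omega),
          Function.update_of_ne (by omega)]
        exact hF.ag_par j h1 hlt
    · intro j hj
      rcases (by omega : j = J ∨ j < J) with rfl | hlt
      · rw [Function.update_self]; omega
      · rw [Function.update_of_ne (by omega)]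
        have := hpar j hlt
        omega
    · intro x (hx : x < J + 1) y (hy : y < J + 1) hxy
      rcases (by omega : x = J ∨ x < J) with hx' | hx' <;>
        rcases (by omega : y = J ∨ y < J) with hy' | hy'
      · exact hx'.trans hy'.symm
      · rw [hx', Function.update_self, Function.update_of_ne (by omega)] at hxy
        exact absurd hxy.symm (hnew y hy')
      · rw [hy', Function.update_self, Function.update_of_ne (by omega)] at hxy
        exact absurd hxy (hnew x hx')
      · rw [Function.update_of_ne (by omega), Function.update_of_ne (by omega)] at hxy
        exact hinj hx' hy' hxy
    · intro j h1 h2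
      rcases (by omega : j = J ∨ j < J) with rfl | hlt
      · rw [Function.update_self, Function.update_self, Function.update_of_ne (by omega), hax]
        exact had
      · have := hF.par_lt j h1 hlt
        rw [Function.update_of_ne (a := j) (by omega), Function.update_of_ne (a := j) (by omega),
          Function.update_of_ne (by omega)]
        exact hadj j h1 hlt
    · intro j hj
      rcases (by omega : j = J ∨ j < J) with rfl | hlt
      · simp only [Function.update_self]
        exact ⟨i.2, d.snd.2⟩
      · rw [Function.update_of_ne (by omega), Function.update_of_ne (by omega)]
        exact hmem j hlt

/-- Every allocation arises from embedding a forest of slots. -/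
theorem IsAllocation.exists_forest {I : ICFDInstance} {π : Fin I.n → Finset (Fin I.m)}
    (h : I.IsAllocation π) :
    ∃ (f : ℕ → Fin I.m) (par ag : ℕ → ℕ), IsForest I.n I.p par ag ∧ (∀ j < I.p, par j < I.p) ∧
      Set.InjOn f (Set.Iio I.p) ∧ (∀ j, I.n ≤ j → j < I.p → I.G.Adj (f (par j)) (f j)) ∧
      ∀ i : Fin I.n, ∑ j ∈ slots I.p ag i, I.u i (f j) = I.value i (π i) := by
  classical
  obtain ⟨f, par, ag, hF, hpar, hinj, hadj, hmem⟩ :=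
    h.exists_partial_forest I.p h.n_le_p le_rfl
  refine ⟨f, par, ag, hF, hpar, hinj, hadj, fun i => ?_⟩
  -- These are `p` distinct vertices in a union of size `p`, so they exhaust it.
  have himg : (Finset.range I.p).image f = Finset.univ.biUnion π := by
    refine Finset.eq_of_subset_of_card_le ?_ ?_
    · intro v hv
      obtain ⟨j, hj, rfl⟩ := Finset.mem_image.1 hv
      obtain ⟨h1, h2⟩ := hmem j (Finset.mem_range.1 hj)
      exact Finset.mem_biUnion.2 ⟨_, Finset.mem_univ _, h2⟩
    · rw [h.card_eq, Finset.card_image_of_injOn, Finset.card_range]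
      intro a ha b hb
      exact hinj (by simpa using ha) (by simpa using hb)
  have hπ : π i = (slots I.p ag i).image f := by
    ext v
    rw [Finset.mem_image]
    constructor
    · intro hv
      have : v ∈ (Finset.range I.p).image f := by
        rw [himg]
        exact Finset.mem_biUnion.2 ⟨i, Finset.mem_univ _, hv⟩
      obtain ⟨j, hj, rfl⟩ := Finset.mem_image.1 this
      rw [Finset.mem_range] at hj
      refine ⟨j, mem_slots.2 ⟨hj, ?_⟩, rfl⟩
      obtain ⟨h1, h2⟩ := hmem j hj
      by_contra hne
      have := h.disjoint ⟨ag j, h1⟩ i (fun h => hne (congrArg Fin.val h))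
      rw [Finset.disjoint_left] at this
      exact this h2 hv
    · rintro ⟨j, hj, rfl⟩
      obtain ⟨hj, hji⟩ := mem_slots.1 hj
      obtain ⟨h1, h2⟩ := hmem j hj
      have h3 : (⟨ag j, h1⟩ : Fin I.n) = i := Fin.ext hji
      rwa [h3] at h2
  rw [hπ, value, Finset.sum_image]
  intro a ha b hb
  exact hinj (mem_slots.1 ha).1 (mem_slots.1 hb).1

end ICFDInstance

/-! ### Coin flips -/

namespace RAM

open MeasureTheory ProbabilityTheory

instance : IsProbabilityMeasure coinMeasure := by
  unfold coinMeasure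
  infer_instance

theorem coinMeasure_cylinder (S : Finset ℕ) (b : ℕ → Bool) :
    coinMeasure.real {ω | ∀ x ∈ S, ω x = b x} = (1 / 2) ^ S.card := by
  have h : {ω : ℕ → Bool | ∀ x ∈ S, ω x = b x} = Set.pi S fun x => {b x} := by
    ext ω
    simp
  rw [h, measureReal_def, coinMeasure, Measure.infinitePi_pi _ fun _ _ => MeasurableSet.singleton _]
  simp

/-- If the blocks `S 0, …, S (N - 1)` of coins are disjoint and a block shows a prescribed pattern
with probability at least `1 / N`, then some block does with probability at least `1 - 1 / e`. -/
theorem le_coinMeasure_exists_block (N : ℕ) (hN : 1 ≤ N) (S : ℕ → Finset ℕ) (b : ℕ → Bool)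
    (hS : ∀ t t', t ≠ t' → Disjoint (S t) (S t')) (hcard : ∀ t, 2 ^ (S t).card ≤ N) :
    1 - 1 / Real.exp 1 ≤ coinMeasure.real {ω | ∃ t < N, ∀ x ∈ S t, ω x = b x} := by
  have hind : iIndepFun (fun (x : ℕ) (ω : ℕ → Bool) => ω x) coinMeasure := by
    have := iIndepFun_infinitePi (P := fun _ : ℕ => (PMF.uniformOfFintype Bool).toMeasure)
      (X := fun _ => id) fun _ => measurable_id
    exact this
  let E : ℕ → Set (ℕ → Bool) := fun t => {ω | ∀ x ∈ S t, ω x = b x}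
  have hE : ∀ t, MeasurableSet (E t) := fun t => by
    have : E t = ⋂ x ∈ S t, (fun ω : ℕ → Bool => ω x) ⁻¹' {b x} := by
      ext ω; simp [E]
    rw [this]
    exact Finset.measurableSet_biInter _ fun x _ =>
      measurable_pi_apply x (MeasurableSet.singleton _)
  have hN' : (1 : ℝ) ≤ N := by exact_mod_cast hN
  have hbound : ∀ t, coinMeasure.real (E t)ᶜ ≤ 1 - 1 / N := fun t => by
    rw [probReal_compl_eq_one_sub (hE t), coinMeasure_cylinder]
    refine sub_le_sub_left ?_ 1
    rw [one_div_pow]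
    refine one_div_le_one_div_of_le (by positivity) ?_
    exact_mod_cast hcard t
  have h0 : (0 : ℝ) ≤ 1 - 1 / N := by
    rw [sub_nonneg, div_le_one (by positivity)]
    exact hN'
  have hmem : ∀ T x, x ∈ (Finset.range T).biUnion S ↔ ∃ t < T, x ∈ S t := fun T x => by simp
  have hfail : ∀ T, coinMeasure.real {ω | ∀ t < T, ω ∉ E t} ≤ (1 - 1 / (N : ℝ)) ^ T := by
    intro T
    induction T with
    | zero => simp
    | succ T ih =>
      let U := (Finset.range T).biUnion S
      have hdisj : Disjoint U (S T) := by
        rw [Finset.disjoint_left]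
        intro x hx
        obtain ⟨t, ht, hxt⟩ := (hmem T x).1 hx
        exact Finset.disjoint_left.1 (hS t T (by omega)) hxt
      -- Failure of the first `T` blocks is an event in the coins of `U` only, failure of block `T`
      -- one in those of `S T`; the sets are disjoint, so the probabilities multiply.
      have hsplit := (hind.indepFun_finset U (S T) hdisj
        fun x => measurable_pi_apply x).measure_inter_preimage_eq_mul
        {y | ∀ t < T, ∃ x, ∃ hx : x ∈ U, x ∈ S t ∧ y ⟨x, hx⟩ ≠ b x} {y | ∀ x, y x = b x}ᶜ
        (Set.toFinite _).measurableSet (Set.toFinite _).measurableSet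
      have e₁ : (fun (ω : ℕ → Bool) (x : U) => ω x) ⁻¹'
          {y | ∀ t < T, ∃ x, ∃ hx : x ∈ U, x ∈ S t ∧ y ⟨x, hx⟩ ≠ b x} =
          {ω | ∀ t < T, ω ∉ E t} := by
        ext ω
        simp only [E, Set.mem_preimage, Set.mem_ofPred_eq, not_forall]
        refine forall₂_congr fun t ht => ⟨?_, ?_⟩
        · rintro ⟨x, hx, hxt, hne⟩
          exact ⟨x, hxt, hne⟩
        · rintro ⟨x, hxt, hne⟩
          exact ⟨x, (hmem T x).2 ⟨t, ht, hxt⟩, hxt, hne⟩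
      have e₂ : (fun (ω : ℕ → Bool) (x : S T) => ω x) ⁻¹' {y | ∀ x, y x = b x}ᶜ = (E T)ᶜ := by
        ext ω
        simp [E]
      have e₃ : {ω | ∀ t < T + 1, ω ∉ E t} = {ω | ∀ t < T, ω ∉ E t} ∩ (E T)ᶜ := by
        ext ω
        simp only [Set.mem_ofPred_eq, Set.mem_inter_iff, Set.mem_compl_iff]
        exact Nat.forall_lt_succ_right
      rw [e₁, e₂] at hsplit
      rw [e₃, measureReal_def, hsplit, ENNReal.toReal_mul, pow_succ]
      exact mul_le_mul ih (hbound T) ENNReal.toReal_nonneg (pow_nonneg h0 T)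
  have hcompl : {ω : ℕ → Bool | ∃ t < N, ∀ x ∈ S t, ω x = b x}ᶜ = {ω | ∀ t < N, ω ∉ E t} := by
    ext ω
    simp [E]
  have hmeas : MeasurableSet {ω : ℕ → Bool | ∃ t < N, ∀ x ∈ S t, ω x = b x} := by
    have : {ω : ℕ → Bool | ∃ t < N, ∀ x ∈ S t, ω x = b x} = ⋃ t ∈ Finset.range N, E t := by
      ext ω
      simp [E]
    rw [this]
    exact Finset.measurableSet_biUnion _ fun t _ => hE t
  have hsum := probReal_add_probReal_compl (μ := coinMeasure) hmeas
  rw [hcompl] at hsum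
  have hexp : (1 - 1 / (N : ℝ)) ^ N ≤ 1 / Real.exp 1 := by
    rw [one_div (Real.exp 1), ← Real.exp_neg]
    exact Real.one_sub_div_pow_le_exp_neg hN'
  linarith [hfail N]

/-! ### Sampling with fair coins. -/

/-- The number in `{p, …, 2 p - 1}` that the coins from `c` on determine. -/
def sample (ω : ℕ → Bool) (p c : ℕ) : ℕ :=
  loop p (fun i y => if y < p then y + y + (if ω (c + i) then 1 else 0) else y) 1

/-- The required coins are the binary digits of `y` after its leading one. Proper prefixes are below
`p`, so the loop keeps appending digits; it freezes once `y` is reached. As `2 ^ d ≤ y < 2 * p`, the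
value has probability at least `1 / (2 p)`, although the samples need not be uniform. -/
theorem exists_bits_sample (p y : ℕ) (hy : p ≤ y) (hy' : y < 2 * p) :
    ∃ (d : ℕ) (b : ℕ → Bool), d ≤ p ∧ 2 ^ d ≤ 2 * p ∧
      ∀ ω c, (∀ i < d, ω (c + i) = b i) → sample ω p c = y := by
  have key : ∀ y, 1 ≤ y → y < 2 * p → ∃ (d : ℕ) (b : ℕ → Bool), 2 ^ d ≤ y ∧
      ∀ (ω : ℕ → Bool) (c : ℕ), (∀ i < d, ω (c + i) = b i) →
        loop d (fun i y => if y < p then y + y + (if ω (c + i) then 1 else 0) else y) 1 = y := by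
    intro y
    induction y using Nat.strong_induction_on with
    | _ y ih =>
      intro h1 h2
      by_cases hy1 : y = 1
      · exact ⟨0, fun _ => false, by simp [hy1], fun _ _ _ => by simp [hy1]⟩
      · obtain ⟨d, b, hd, hb⟩ := ih (y / 2) (by omega) (by omega) (by omega)
        refine ⟨d + 1, Function.update b d (decide (y % 2 = 1)), by rw [pow_succ]; omega,
          fun ω c hω => ?_⟩
        rw [loop_succ, hb ω c fun i hi => by
          rw [hω i (by omega), Function.update_of_ne (by omega)], if_pos (by omega),
          hω d (by omega), Function.update_self]
        rcases Nat.mod_two_eq_zero_or_one y with h | h <;> simp [h] <;> omega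
  obtain ⟨d, b, hd, hb⟩ := key y (by omega) hy'
  have hdp : d ≤ p := by
    by_contra hlt
    have h1 : 2 ^ (p + 1) ≤ 2 ^ d := Nat.pow_le_pow_right (by omega) (by omega)
    have h2 := Nat.lt_two_pow_self (n := p)
    rw [pow_succ] at h1
    omega
  refine ⟨d, b, hdp, by omega, fun ω c hω => ?_⟩
  have hstay : ∀ r, loop (d + r)
      (fun i y => if y < p then y + y + (if ω (c + i) then 1 else 0) else y) 1 = y := by
    intro r
    induction r with
    | zero => exact hb ω c hω
    | succ r ih => rw [← Nat.add_assoc, loop_succ, ih, if_neg (by omega)]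
  have := hstay (p - d)
  rwa [Nat.add_sub_cancel' hdp] at this

/-- Among `(2 p) ^ (3 p)` rounds of `R` samples each, with probability at least `1 - 1 / e` there is
one in which at most `3 p` chosen samples have prescribed values. -/
theorem le_coinMeasure_exists_samples (p R : ℕ) (hp : 1 ≤ p) (J : Finset ℕ) (hJ : ∀ s ∈ J, s < R)
    (hcard : J.card ≤ 3 * p) (y : ℕ → ℕ) (hy : ∀ s ∈ J, p ≤ y s ∧ y s < 2 * p) :
    1 - 1 / Real.exp 1 ≤ coinMeasure.real
      {ω | ∃ t < (2 * p) ^ (3 * p), ∀ s ∈ J, sample ω p (t * (R * p) + s * p) = y s} := by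
  have hex : ∀ s, ∃ (d : ℕ) (b : ℕ → Bool), s ∈ J → d ≤ p ∧ 2 ^ d ≤ 2 * p ∧
      ∀ ω c, (∀ i < d, ω (c + i) = b i) → sample ω p c = y s := fun s => by
    by_cases hs : s ∈ J
    · obtain ⟨d, b, h⟩ := exists_bits_sample p (y s) (hy s hs).1 (hy s hs).2
      exact ⟨d, b, fun _ => h⟩
    · exact ⟨0, fun _ => true, fun h => absurd h hs⟩
  choose d b hdb using hex
  let S : ℕ → Finset ℕ := fun t =>
    J.biUnion fun s => (Finset.range (d s)).image fun i => t * (R * p) + s * p + i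
  have hmem : ∀ t x, x ∈ S t ↔ ∃ s ∈ J, ∃ i < d s, t * (R * p) + s * p + i = x := fun t x => by
    simp [S]
  -- A coin number is a mixed-radix triple (round, sample, coin) with radices `R` and `p`. Decoding
  -- it makes the blocks disjoint and lets a single pattern, independent of `t`, serve all rounds.
  have hdecode : ∀ t, ∀ s ∈ J, ∀ i < d s, (t * (R * p) + s * p + i) % p = i ∧
      (t * (R * p) + s * p + i) / p % R = s ∧ (t * (R * p) + s * p + i) / p / R = t := by
    intro t s hs i hi
    have hi' : i < p := hi.trans_le (hdb s hs).1
    have hs' := hJ s hs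
    have h1 : t * (R * p) + s * p + i = i + p * (s + R * t) := by ring
    have h2 : (t * (R * p) + s * p + i) / p = s + R * t := by
      rw [h1, Nat.add_mul_div_left _ _ (by omega), Nat.div_eq_of_lt hi', zero_add]
    rw [h2]
    refine ⟨?_, ?_, ?_⟩
    · rw [h1, Nat.add_mul_mod_self_left, Nat.mod_eq_of_lt hi']
    · rw [Nat.add_mul_mod_self_left, Nat.mod_eq_of_lt hs']
    · rw [Nat.add_mul_div_left _ _ (by omega), Nat.div_eq_of_lt hs', zero_add]
  refine (le_coinMeasure_exists_block ((2 * p) ^ (3 * p)) (Nat.one_le_pow _ _ (by omega)) S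
    (fun x => b (x / p % R) (x % p)) ?_ ?_).trans (measureReal_mono ?_)
  · intro t t' htt'
    rw [Finset.disjoint_left]
    intro x hx hx'
    obtain ⟨s, hs, i, hi, rfl⟩ := (hmem _ _).1 hx
    obtain ⟨s', hs', i', hi', he⟩ := (hmem _ _).1 hx'
    have h1 := (hdecode t s hs i hi).2.2
    rw [← he, (hdecode t' s' hs' i' hi').2.2] at h1
    exact htt' h1.symm
  · intro t
    calc 2 ^ (S t).card ≤ 2 ^ ∑ s ∈ J, d s := by
          refine Nat.pow_le_pow_right (by omega) (Finset.card_biUnion_le.trans ?_)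
          refine Finset.sum_le_sum fun s _ => ?_
          simpa using Finset.card_image_le (s := Finset.range (d s))
            (f := fun i => t * (R * p) + s * p + i)
      _ = ∏ s ∈ J, 2 ^ d s := (Finset.prod_pow_eq_pow_sum _ _ _).symm
      _ ≤ ∏ _s ∈ J, 2 * p := Finset.prod_le_prod' fun s hs => (hdb s hs).2.1
      _ = (2 * p) ^ J.card := by simp
      _ ≤ (2 * p) ^ (3 * p) := Nat.pow_le_pow_right (by omega) hcard
  · rintro ω ⟨t, ht, hω⟩
    refine ⟨t, ht, fun s hs => (hdb s hs).2.2 ω _ fun i hi => ?_⟩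
    have := hω _ ((hmem t _).2 ⟨s, hs, i, hi, rfl⟩)
    rw [this, (hdecode t s hs i hi).1, (hdecode t s hs i hi).2.1]

end RAM

/-! ### The algorithm -/

namespace RAM

namespace Ex

/-- `if a = b then x else y` -/
def ifEq (a b x y : Ex) : Ex := .ifLt a b y (.ifLt b a y x)

theorem eval_ifEq (inp mem : ℕ → ℕ) (a b x y : Ex) (d : ℕ) (env : ℕ → ℕ) :
    (ifEq a b x y).eval inp mem d env =
      if a.eval inp mem d env = b.eval inp mem d env then x.eval inp mem d env
      else y.eval inp mem d env := by
  simp only [ifEq, eval]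
  split_ifs <;> first | rfl | omega

/-- In scope `d`, the product of variable `i` and the expression `a`, which must not use variables
from `d` on. -/
def mul (d i : ℕ) (a : Ex) : Ex := .fold i (.const 0) (.add (.var d) a)

/-- Sample number `a`. -/
def smp (a : Ex) : Ex := .load (.add (.const 2) a)

/-- The table entry of vertex `a`. -/
def tbl (a : Ex) : Ex := .load (.add (.add (.const 2) (.var 3)) a)

/-- The number of rounds, `(2 p) ^ (3 p)`, in scope `4`. -/
def rounds : Ex :=
  -- Each iteration multiplies the accumulator by `8 p³`, and `(8 p³) ^ p = (2 p) ^ (3 p)`.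
  .fold 2 (.const 1) (mul 6 2 (mul 8 2 (mul 10 2
    (.add (.add (.add (.var 4) (.var 4)) (.add (.var 4) (.var 4)))
      (.add (.add (.var 4) (.var 4)) (.add (.var 4) (.var 4)))))))

/-- The slot treated in round `t` of the dynamic program, where `t` is variable `6`. -/
def slot : Ex := .sub (.sub (.var 2) (.const 1)) (.var 6)

/-- The largest table entry of a neighbour of vertex `7` that has the colour of slot `9`, in
scope `10`. -/
def best : Ex :=
  .fold 0 (.const 0) (ifEq (smp (.var 11)) (.add (.var 2) (.var 9))
    (.ifLt (.const 0) (.read (.add (.add (.const 3) (mul 12 0 (.var 7))) (.var 11)))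
      -- With truncated subtraction, `acc + (x - acc)` is the maximum.
      (.add (.var 10) (.sub (tbl (.var 11)) (.var 10))) (.var 10)) (.var 10))

/-- The table entry of vertex `7`, in scope `8`. -/
def entry : Ex :=
  .fold 2
    -- Samples are stored shifted by `p`. The first `m` are the colours of the vertices, the next
    -- `p` the parents and the last `p` the agents of the slots.
    (.add (.const 1) (.read (.add (.add (.add (.const 3) (mul 8 0 (.var 0)))
      (mul 8 0 (.sub (smp (.add (.add (.var 0) (.var 2)) slot)) (.var 2)))) (.var 7))))
    (.ifLt (.var 9) (.var 1) (.var 8)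
      (ifEq (smp (.add (.var 0) (.var 9))) (.add (.var 2) slot)
        (.ifLt (.const 0) best
          -- Zero marks infeasibility and is absorbing; otherwise subtracting one merges the two
          -- offsets.
          (.ifLt (.const 0) (.var 8) (.sub (.add (.var 8) best) (.const 1)) (.const 0))
          (.const 0))
        (.var 8)))

/-- Whether some vertex with the colour of slot `7` has a sufficient table entry, in scope `8`. -/
def satisfied : Ex :=
  .fold 0 (.const 0) (ifEq (smp (.var 9)) (.add (.var 2) (.var 7))
    -- Comparing `n W` with `u(V) + n` tests `W - 1 ≥ u(V) / n` without division.
    (.ifLt (mul 10 1 (tbl (.var 9)))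
      (.add (.fold 0 (.const 0) (.add (.var 10) (.read (.add (.add (.add (.const 3)
        (mul 12 0 (.var 0))) (mul 12 0 (.var 7))) (.var 11))))) (.var 1))
      (.var 8) (.const 1)) (.var 8))

/-- Whether the samples describe a forest and all agents are satisfied, in scope `6`. -/
def check : Ex :=
  .fold 2 (.const 1) (.ifLt (.var 7) (.var 1)
    (ifEq (smp (.add (.add (.var 0) (.var 2)) (.var 7))) (.add (.var 2) (.var 7))
      (.ifLt (.const 0) satisfied (.var 6) (.const 0)) (.const 0))
    (.ifLt (smp (.add (.var 0) (.var 7))) (.add (.var 2) (.var 7))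
      (ifEq (smp (.add (.add (.var 0) (.var 2)) (.var 7)))
        (smp (.add (.add (.var 0) (.var 2)) (.sub (smp (.add (.var 0) (.var 7))) (.var 2))))
        (.var 6) (.const 0)) (.const 0)))

end Ex

namespace Cmd

/-- Draw all samples, in scope `6`. -/
def draw : Cmd :=
  .loop 3 (.seq (.store (.add (.const 2) (.var 6)) (.const 1))
    -- All `p` coins are flipped even if the sample is already fixed, so every sample starts at a
    -- predictable coin. Cell `1` only buffers the coin.
    (.loop 2 (.seq (.flip (.const 1))
      (.store (.add (.const 2) (.var 6))
        (.ifLt (.smp (.var 6)) (.var 2)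
          (.add (.add (.smp (.var 6)) (.smp (.var 6))) (.load (.const 1))) (.smp (.var 6)))))))

/-- Fill the table, from the last slot to the first, in scope `6`. -/
def fill : Cmd :=
  .loop 2 (.loop 0
    (.ifLt (.smp (.var 7)) (.add (.var 2) .slot) .skip
      (.ifLt (.add (.var 2) .slot) (.smp (.var 7)) .skip
        (.store (.add (.add (.const 2) (.var 3)) (.var 7)) .entry))))

/-- One round of the algorithm, in scope `6`: if the check succeeds, then count this in memory
cell `0`. -/
def round : Cmd :=
  .seq draw (.seq fill (.store (.const 0) (.add (.load (.const 0)) .check)))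

end Cmd

/-- Bind variable `d` to the value of an expression. -/
def Program.bind (d : ℕ) (e : Ex) : Program := .seq (e.compile d 0) (.move (2 * d) 1)

/-- The algorithm. The variables `0, …, 4` are the numbers of items, of agents, of items to
allocate, of samples and of rounds. -/
def algorithm : Program :=
  .seq (.bind 0 (.read (.const 0))) (.seq (.bind 1 (.read (.const 1)))
    -- Registers `4` and `2` hold variables `2` and `1`, so this rejects if `p < n`.
    (.seq (.bind 2 (.read (.const 2))) (.ifLt 4 2 (.const 0 0)
      (.seq (.bind 3 (.add (.var 0) (.add (.var 2) (.var 2)))) (.seq (.bind 4 .rounds)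
        (.seq (Cmd.compile (.loop 4 .round) 5)
          (.seq ((Ex.load (.const 0)).compile 5 0) (.move 0 1))))))))

/-! ### The values of the expressions -/

theorem loop_add_const (n c : ℕ) : loop n (fun _ acc => acc + c) 0 = n * c := by
  induction n with
  | zero => simp
  | succ n ih => rw [loop_succ, ih, Nat.add_mul, Nat.one_mul]

theorem loop_mul_const (n c : ℕ) : loop n (fun _ acc => c * acc) 1 = c ^ n := by
  induction n with
  | zero => simp
  | succ n ih => rw [loop_succ, ih, pow_succ, Nat.mul_comm]

theorem loop_add (n : ℕ) (f : ℕ → ℕ) :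
    loop n (fun k acc => acc + f k) 0 = ∑ k ∈ Finset.range n, f k := by
  induction n with
  | zero => simp
  | succ n ih => rw [loop_succ, ih, Finset.sum_range_succ]

theorem loop_all (n : ℕ) (P : ℕ → Prop) [DecidablePred P] :
    loop n (fun k acc => if P k then acc else 0) 1 = if ∀ k < n, P k then 1 else 0 := by
  induction n with
  | zero => simp
  | succ n ih =>
    rw [loop_succ, ih]
    simp only [Nat.forall_lt_succ_right]
    split_ifs <;> first | rfl | (exfalso; tauto)

theorem loop_any (n : ℕ) (P : ℕ → Prop) [DecidablePred P] :
    loop n (fun k acc => if P k then 1 else acc) 0 = if ∃ k < n, P k then 1 else 0 := by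
  induction n with
  | zero => simp
  | succ n ih =>
    rw [loop_succ, ih]
    simp only [Nat.exists_lt_succ_right]
    by_cases h : P n <;> simp [h]

theorem le_loop_max (n : ℕ) (P : ℕ → Prop) [DecidablePred P] (g : ℕ → ℕ) (w : ℕ) (hw : w < n)
    (hP : P w) : g w ≤ loop n (fun w acc => if P w then acc + (g w - acc) else acc) 0 := by
  induction n with
  | zero => omega
  | succ n ih =>
    rw [loop_succ]
    rcases (by omega : w = n ∨ w < n) with rfl | h
    · rw [if_pos hP]; omega
    · have := ih h
      split_ifs <;> omega

theorem exists_loop_max (n : ℕ) (P : ℕ → Prop) [DecidablePred P] (g : ℕ → ℕ)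
    (h : 0 < loop n (fun w acc => if P w then acc + (g w - acc) else acc) 0) :
    ∃ w < n, P w ∧ g w = loop n (fun w acc => if P w then acc + (g w - acc) else acc) 0 := by
  induction n with
  | zero => simp at h
  | succ n ih =>
    rw [loop_succ] at h ⊢
    set x := loop n (fun w acc => if P w then acc + (g w - acc) else acc) 0
    by_cases hP : P n
    · rw [if_pos hP] at h ⊢
      by_cases hlt : x < g n
      · exact ⟨n, by omega, hP, by omega⟩
      · obtain ⟨w, h1, h2, h3⟩ := ih (by omega)
        exact ⟨w, by omega, h2, by omega⟩
    · rw [if_neg hP] at h ⊢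
      obtain ⟨w, h1, h2, h3⟩ := ih h
      exact ⟨w, by omega, h2, h3⟩

/-- Zero is absorbing, and otherwise iteration `k` adds `M k - 1`; this is the closed form of the
dynamic programming step. -/
theorem loop_combine (n : ℕ) (P : ℕ → Prop) [DecidablePred P] (M : ℕ → ℕ) (x : ℕ) (hx : 0 < x) :
    loop n (fun k acc => if P k then if 0 < M k then if 0 < acc then acc + M k - 1 else 0 else 0
      else acc) x =
      if ∀ k < n, P k → 0 < M k then x + ∑ k ∈ (Finset.range n).filter P, (M k - 1) else 0 := by
  induction n with
  | zero => simp
  | succ n ih =>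
    rw [loop_succ, ih]
    simp only [Nat.forall_lt_succ_right, Finset.range_add_one, Finset.filter_insert]
    by_cases hP : P n
    · simp only [hP, if_true]
      rw [Finset.sum_insert (by simp)]
      by_cases hM : 0 < M n
      · by_cases hA : ∀ k < n, P k → 0 < M k
        · simp only [hM, if_true, forall_true_left]
          split_ifs <;> first | omega | (exfalso; tauto)
        · simp [hM, hA]
      · simp [hM]
    · simp [hP]

/-- The largest table entry of a neighbour of `v` with the colour of slot `k`. -/
def bestVal (inp mem : ℕ → ℕ) (m p R v k : ℕ) : ℕ :=
  loop m (fun w acc => if mem (2 + w) = p + k ∧ 0 < inp (3 + m * v + w) then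
    acc + (mem (2 + R + w) - acc) else acc) 0

/-- The table entry of `v` for slot `j`. -/
def entryVal (inp mem : ℕ → ℕ) (m n p R v j : ℕ) : ℕ :=
  loop p (fun k acc => if n ≤ k ∧ mem (2 + (m + k)) = p + j then
      if 0 < bestVal inp mem m p R v k then
        if 0 < acc then acc + bestVal inp mem m p R v k - 1 else 0 else 0
    else acc) (1 + inp (3 + m * m + m * (mem (2 + (m + p + j)) - p) + v))

theorem Ex.eval_rounds (inp mem env : ℕ → ℕ) :
    Ex.rounds.eval inp mem 4 env = (2 * env 2) ^ (3 * env 2) := by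
  have h : (2 * env 2) ^ (3 * env 2) = (env 2 * env 2 * env 2 * 8) ^ env 2 := by
    rw [pow_mul]
    congr 1
    ring
  rw [h, ← loop_mul_const]
  simp only [Ex.rounds, Ex.mul, Ex.eval]
  congr 1
  funext k acc
  simp [loop_add_const]
  ring

theorem Ex.eval_best (inp mem env : ℕ → ℕ) :
    Ex.best.eval inp mem 10 env = bestVal inp mem (env 0) (env 2) (env 3) (env 7) (env 9) := by
  simp only [Ex.best, Ex.mul, Ex.smp, Ex.tbl, Ex.eval, Ex.eval_ifEq, bestVal]
  congr 1
  funext w acc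
  simp [loop_add_const, ite_and]

theorem Ex.eval_entry (inp mem env : ℕ → ℕ) :
    Ex.entry.eval inp mem 8 env =
      entryVal inp mem (env 0) (env 1) (env 2) (env 3) (env 7) (env 2 - 1 - env 6) := by
  simp only [Ex.entry, Ex.slot, Ex.mul, Ex.smp, Ex.eval, Ex.eval_ifEq, entryVal]
  congr 1
  · funext k acc
    by_cases h : k < env 1
    · simp [h]
    · simp [h, not_lt.1 h, Ex.eval_best]
  · simp [loop_add_const]

theorem Ex.eval_satisfied (inp mem env : ℕ → ℕ) :
    Ex.satisfied.eval inp mem 8 env =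
      if ∃ w < env 0, mem (2 + w) = env 2 + env 7 ∧
        ∑ v ∈ Finset.range (env 0), inp (3 + env 0 * env 0 + env 0 * env 7 + v) + env 1 ≤
          env 1 * mem (2 + env 3 + w) then 1 else 0 := by
  rw [← loop_any]
  simp only [Ex.satisfied, Ex.mul, Ex.smp, Ex.tbl, Ex.eval, Ex.eval_ifEq]
  congr 1
  funext w acc
  have h : ∀ a b : ℕ, (if a < b then acc else 1) = if b ≤ a then 1 else acc := fun a b => by
    split_ifs <;> omega
  simp [loop_add_const, loop_add, ite_and, h]

theorem Ex.eval_check (inp mem env : ℕ → ℕ) :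
    Ex.check.eval inp mem 6 env =
      if ∀ j < env 2, if j < env 1 then mem (2 + (env 0 + env 2 + j)) = env 2 + j ∧
          ∃ w < env 0, mem (2 + w) = env 2 + j ∧
            ∑ v ∈ Finset.range (env 0), inp (3 + env 0 * env 0 + env 0 * j + v) + env 1 ≤
              env 1 * mem (2 + env 3 + w)
        else mem (2 + (env 0 + j)) < env 2 + j ∧ mem (2 + (env 0 + env 2 + j)) =
          mem (2 + (env 0 + env 2 + (mem (2 + (env 0 + j)) - env 2)))
      then 1 else 0 := by
  rw [← loop_all]
  simp only [Ex.check, Ex.smp, Ex.eval, Ex.eval_ifEq]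
  congr 1
  funext j acc
  by_cases h : j < env 1
  · have h' : ∀ (P : Prop) [Decidable P], (0 < if P then 1 else 0) ↔ P := fun P _ => by
      by_cases hP : P <;> simp [hP]
    simp [h, ite_and, Ex.eval_satisfied, h']
  · simp [h, ite_and]

end RAM

/-! ### The effect of a round -/

namespace RAM

theorem loop_induction {α : Type*} {n : ℕ} {f : ℕ → α → α} {x : α} (Inv : ℕ → α → Prop)
    (h0 : Inv 0 x) (hstep : ∀ k < n, ∀ a, Inv k a → Inv (k + 1) (f k a)) :
    Inv n (loop n f x) := by
  induction n with
  | zero => exact h0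
  | succ n ih => exact hstep n (by omega) _ (ih fun k hk => hstep k (by omega))

theorem loop_congr {α : Type*} {n : ℕ} {f g : ℕ → α → α} {x : α}
    (h : ∀ k < n, ∀ a, f k a = g k a) : loop n f x = loop n g x := by
  induction n with
  | zero => rfl
  | succ n ih => rw [loop_succ, loop_succ, ih fun k hk => h k (by omega), h n (by omega)]

/-- Below `p` the value grows by at least one per iteration, starting from `1`. -/
theorem le_sample (ω : ℕ → Bool) (p c : ℕ) : p ≤ sample ω p c := by
  have h := loop_induction (n := p) (x := 1)
    (f := fun i y => if y < p then y + y + (if ω (c + i) then 1 else 0) else y)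
    (fun i y => p ≤ y ∨ i + 1 ≤ y) (by omega) (fun i _ y hy => by
      split_ifs <;> omega)
  unfold sample
  omega

theorem Cmd.exec_draw (inp : ℕ → ℕ) (ω : ℕ → Bool) (env : ℕ → ℕ) (σ : (ℕ → ℕ) × ℕ) :
    (draw.exec inp ω 6 env σ).2 = σ.2 + env 3 * env 2 ∧
      (draw.exec inp ω 6 env σ).1 0 = σ.1 0 ∧
      ∀ j < env 3, (draw.exec inp ω 6 env σ).1 (2 + j) = sample ω (env 2) (σ.2 + j * env 2) := by
  unfold draw
  rw [Cmd.exec]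
  refine loop_induction (fun k (τ : (ℕ → ℕ) × ℕ) => τ.2 = σ.2 + k * env 2 ∧ τ.1 0 = σ.1 0 ∧
    ∀ j < k, τ.1 (2 + j) = sample ω (env 2) (σ.2 + j * env 2)) (by simp) ?_
  rintro k hk τ ⟨h1, h2, h3⟩
  rw [Cmd.exec]
  have key := loop_induction (n := Function.update env 6 k 2)
    (f := fun i τ => Cmd.exec inp ω (.seq (.flip (.const 1)) (.store (.add (.const 2) (.var 6))
        (.ifLt (.smp (.var 6)) (.var 2)
          (.add (.add (.smp (.var 6)) (.smp (.var 6))) (.load (.const 1))) (.smp (.var 6)))))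
        (6 + 1 + 1) (Function.update (Function.update env 6 k) (6 + 1) i) τ)
    (x := Cmd.exec inp ω (.store (.add (.const 2) (.var 6)) (.const 1)) (6 + 1)
      (Function.update env 6 k) τ)
    (fun i (τ' : (ℕ → ℕ) × ℕ) => τ'.2 = τ.2 + i ∧
      τ'.1 (2 + k) = RAM.loop i
        (fun i y => if y < env 2 then y + y + (if ω (τ.2 + i) then 1 else 0) else y) 1 ∧
      ∀ x, x ≠ 1 → x ≠ 2 + k → τ'.1 x = τ.1 x) ?_ ?_
  · obtain ⟨k1, k2, k3⟩ := key
    have hp : Function.update env 6 k 2 = env 2 := by simp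
    refine ⟨k1.trans (by rw [hp, h1]; ring), (k3 0 (by omega) (by omega)).trans h2,
      fun j hj => ?_⟩
    rcases (by omega : j = k ∨ j < k) with rfl | hlt
    · refine k2.trans ?_
      rw [hp, h1]
      rfl
    · exact (k3 _ (by omega) (by omega)).trans (h3 j hlt)
  · refine ⟨by simp [Cmd.exec], by simp [Cmd.exec, Ex.eval], fun x _ hx => ?_⟩
    simp [Cmd.exec, Ex.eval, Function.update_of_ne hx]
  · rintro i hi τ' ⟨k1, k2, k3⟩
    refine ⟨by simp [Cmd.exec, k1, Nat.add_assoc], ?_, fun x hx hx' => ?_⟩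
    · rw [loop_succ, ← k2, ← k1]
      have h21 : 2 + k ≠ 1 := by omega
      simp [Cmd.exec, Ex.eval, Ex.smp, Function.update_of_ne h21]
    · simp [Cmd.exec, Ex.eval, Function.update_of_ne hx, Function.update_of_ne hx', k3 x hx hx']

/-- The entry for slot `j` reads only table entries at colours of children of `j`, which are larger
than `j`. Neither later passes nor leftovers from earlier rounds can change it. -/
theorem entryVal_congr {inp μ μ' : ℕ → ℕ} {m n p R v j : ℕ} (hR : m + (p + p) ≤ R) (hj : j < p)
    (hF : ∀ k, n ≤ k → k < p → μ (2 + (m + k)) < p + k) (hlow : ∀ x < 2 + R, μ' x = μ x)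
    (htbl : ∀ w < m, ∀ k < p, j < k → μ (2 + w) = p + k → μ' (2 + R + w) = μ (2 + R + w)) :
    entryVal inp μ' m n p R v j = entryVal inp μ m n p R v j := by
  unfold entryVal
  rw [hlow (2 + (m + p + j)) (by omega)]
  refine loop_congr fun k hk a => ?_
  rw [hlow (2 + (m + k)) (by omega)]
  by_cases h : n ≤ k ∧ μ (2 + (m + k)) = p + j
  · have hjk : j < k := by
      have := hF k h.1 hk
      omega
    have hb : bestVal inp μ' m p R v k = bestVal inp μ m p R v k := by
      refine loop_congr fun w hw a => ?_
      rw [hlow (2 + w) (by omega)]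
      by_cases hc : μ (2 + w) = p + k
      · rw [htbl w hw k hk hjk hc]
      · simp [hc]
    rw [hb]
  · simp [h]

/-- Filling the table, if variables `0, …, 3` are `m`, `n`, `p` and `R`. -/
theorem Cmd.exec_fill (inp : ℕ → ℕ) (ω : ℕ → Bool) (env : ℕ → ℕ) (σ : (ℕ → ℕ) × ℕ) {m n p R : ℕ}
    (hm : env 0 = m) (hn : env 1 = n) (hp : env 2 = p) (hr : env 3 = R) (hR : m + (p + p) ≤ R) :
    (fill.exec inp ω 6 env σ).2 = σ.2 ∧
      (∀ x < 2 + R, (fill.exec inp ω 6 env σ).1 x = σ.1 x) ∧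
      ((∀ k, n ≤ k → k < p → σ.1 (2 + (m + k)) < p + k) →
        ∀ v < m, ∀ j < p, σ.1 (2 + v) = p + j → (fill.exec inp ω 6 env σ).1 (2 + R + v) =
          entryVal inp (fill.exec inp ω 6 env σ).1 m n p R v j) := by
  unfold fill
  rw [Cmd.exec, hp]
  have key := loop_induction (n := p) (x := σ)
    (f := fun t τ => Cmd.exec inp ω (.loop 0
      (.ifLt (.smp (.var 7)) (.add (.var 2) .slot) .skip
        (.ifLt (.add (.var 2) .slot) (.smp (.var 7)) .skip
          (.store (.add (.add (.const 2) (.var 3)) (.var 7)) .entry)))) (6 + 1)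
      (Function.update env 6 t) τ)
    -- After `t` passes the entries for the slots from `p - t` on are final.
    (fun t (τ : (ℕ → ℕ) × ℕ) => τ.2 = σ.2 ∧ (∀ x < 2 + R, τ.1 x = σ.1 x) ∧
      ((∀ k, n ≤ k → k < p → σ.1 (2 + (m + k)) < p + k) →
        ∀ v < m, ∀ j < p, p ≤ j + t → σ.1 (2 + v) = p + j →
          τ.1 (2 + R + v) = entryVal inp τ.1 m n p R v j))
    ⟨rfl, fun _ _ => rfl, fun _ v _ j h1 h2 => absurd h1 (by omega)⟩ ?_
  · refine ⟨key.1, key.2.1, fun hF v hv j hj hc => key.2.2 hF v hv j hj (by omega) hc⟩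
  · rintro t ht τ ⟨h1, h2, h3⟩
    rw [Cmd.exec]
    have hupd : Function.update env 6 t 0 = m := by simp [hm]
    rw [hupd]
    have inner := loop_induction (n := m) (x := τ)
      (f := fun v τ => Cmd.exec inp ω
        (.ifLt (.smp (.var 7)) (.add (.var 2) .slot) .skip
          (.ifLt (.add (.var 2) .slot) (.smp (.var 7)) .skip
            (.store (.add (.add (.const 2) (.var 3)) (.var 7)) .entry))) (6 + 1 + 1)
        (Function.update (Function.update env 6 t) (6 + 1) v) τ)
      -- Within a pass only entries of the current colour change, so new entries can be evaluated in
      -- the memory `τ` at its start.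
      (fun v (τ' : (ℕ → ℕ) × ℕ) => τ'.2 = σ.2 ∧ (∀ x < 2 + R, τ'.1 x = σ.1 x) ∧
        (∀ w, σ.1 (2 + w) ≠ p + (p - 1 - t) → τ'.1 (2 + R + w) = τ.1 (2 + R + w)) ∧
        ((∀ k, n ≤ k → k < p → σ.1 (2 + (m + k)) < p + k) →
          ∀ v' < v, σ.1 (2 + v') = p + (p - 1 - t) →
            τ'.1 (2 + R + v') = entryVal inp τ.1 m n p R v' (p - 1 - t)))
      ⟨h1, h2, fun _ _ => rfl, fun _ v' h => absurd h (by omega)⟩ ?_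
    · obtain ⟨i1, i2, i3, i4⟩ := inner
      refine ⟨i1, i2, fun hF v hv j hj hjt hc => ?_⟩
      rw [entryVal_congr (μ := τ.1) hR hj]
      · by_cases hjj : j = p - 1 - t
        · rw [hjj] at hc ⊢
          exact i4 hF v hv hc
        · rw [i3 v (by omega), h3 hF v hv j hj (by omega) hc]
      · intro k hk hkp
        rw [h2 _ (by omega)]
        exact hF k hk hkp
      · intro x hx
        rw [i2 x hx, h2 x hx]
      · intro w hw k hk hjk hc'
        rw [h2 _ (by omega)] at hc'
        exact i3 w (by omega)
    · rintro v hv τ' ⟨i1, i2, i3, i4⟩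
      have e7 : τ'.1 (2 + v) = σ.1 (2 + v) := i2 _ (by omega)
      have hfun : Cmd.exec inp ω
          (.ifLt (.smp (.var 7)) (.add (.var 2) .slot) .skip
            (.ifLt (.add (.var 2) .slot) (.smp (.var 7)) .skip
              (.store (.add (.add (.const 2) (.var 3)) (.var 7)) .entry))) (6 + 1 + 1)
          (Function.update (Function.update env 6 t) (6 + 1) v) τ' =
          if σ.1 (2 + v) = p + (p - 1 - t) then
            (Function.update τ'.1 (2 + R + v) (entryVal inp τ'.1 m n p R v (p - 1 - t)), τ'.2)
          else τ' := by
        simp only [Cmd.exec, Ex.eval, Ex.smp, Ex.slot, Ex.eval_entry, Nat.reduceAdd]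
        simp only [Function.update_apply]
        simp only [Nat.reduceEqDiff, if_false, if_true, hm, hn, hp, hr, e7]
        split_ifs <;> first | rfl | omega
      rw [hfun]
      split_ifs with hc
      · refine ⟨i1, fun x hx => ?_, fun w hw => ?_, fun hF v' hv' hc' => ?_⟩ <;> dsimp only
        · rw [Function.update_of_ne (by omega), i2 x hx]
        · rw [Function.update_of_ne, i3 w hw]
          intro he
          have : w = v := by omega
          exact hw (this ▸ hc)
        · rcases (by omega : v' = v ∨ v' < v) with rfl | hlt
          · rw [Function.update_self]
            refine entryVal_congr hR (by omega) ?_ ?_ ?_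
            · intro k hk hkp
              rw [h2 _ (by omega)]
              exact hF k hk hkp
            · intro x hx
              rw [i2 x hx, h2 x hx]
            · intro w hw k hk hjk hc'
              rw [h2 _ (by omega)] at hc'
              exact i3 w (by omega)
          · rw [Function.update_of_ne (by omega), i4 hF v' hlt hc']
      · refine ⟨i1, i2, i3, fun hF v' hv' hc' => ?_⟩
        rcases (by omega : v' = v ∨ v' < v) with rfl | hlt
        · exact absurd hc' hc
        · exact i4 hF v' hlt hc'

end RAM

/-! ### Correctness of a round -/

namespace ICFDInstance

open RAM

open Classical in
theorem encode_adj (I : ICFDInstance) (v w : Fin I.m) :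
    I.encode (3 + I.m * v + w) = if I.G.Adj v w then 1 else 0 := by
  have hlt : I.m * v + w < I.m * I.m := by
    calc I.m * v + w < I.m * v + I.m := by omega
      _ = I.m * (v + 1) := by ring
      _ ≤ I.m * I.m := Nat.mul_le_mul_left _ v.2
  rw [show 3 + I.m * (v : ℕ) + w = (I.m * v + w) + 3 by ring, encode, dif_pos hlt]
  have h1 : Fin.divNat ⟨I.m * v + w, hlt⟩ = v := by
    ext
    simp [Fin.divNat, Nat.mul_add_div (v.pos), Nat.div_eq_of_lt w.2]
  have h2 : Fin.modNat ⟨I.m * v + w, hlt⟩ = w := by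
    ext
    simp [Fin.modNat, Nat.mod_eq_of_lt w.2]
  rw [h1, h2]

theorem encode_u (I : ICFDInstance) (i : Fin I.n) (v : Fin I.m) :
    I.encode (3 + I.m * I.m + I.m * i + v) = I.u i v := by
  have hlt : I.m * i + v < I.n * I.m := by
    calc I.m * i + v < I.m * i + I.m := by omega
      _ = I.m * (i + 1) := by ring
      _ ≤ I.m * I.n := Nat.mul_le_mul_left _ i.2
      _ = I.n * I.m := Nat.mul_comm _ _
  have hsub : I.m * I.m + I.m * i + v - I.m * I.m = I.m * i + v := by omega
  rw [show 3 + I.m * I.m + I.m * (i : ℕ) + v = (I.m * I.m + I.m * i + v) + 3 by ring, encode,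
    dif_neg (by omega), dif_pos (by rwa [hsub])]
  have h1 : Fin.divNat
      (⟨I.m * I.m + I.m * i + v - I.m * I.m, by rwa [hsub]⟩ : Fin (I.n * I.m)) = i := by
    ext
    simp only [Fin.divNat, hsub]
    simp [Nat.mul_add_div (v.pos), Nat.div_eq_of_lt v.2]
  have h2 : Fin.modNat
      (⟨I.m * I.m + I.m * i + v - I.m * I.m, by rwa [hsub]⟩ : Fin (I.n * I.m)) = v := by
    ext
    simp only [Fin.modNat, hsub]
    simp [Nat.mod_eq_of_lt v.2]
  rw [h1, h2]

/-- By `loop_combine` an entry is one plus the utility plus the sum of `bestVal - 1` over the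
children. Maximisers give `attained`, maximality gives `upper`. -/
theorem isTable_of_entryVal (I : ICFDInstance) (μ : ℕ → ℕ) (R : ℕ) (hR : I.m + (I.p + I.p) ≤ R)
    (hge : ∀ x < R, I.p ≤ μ (2 + x))
    (hent : ∀ v < I.m, ∀ j < I.p, μ (2 + v) = I.p + j →
      μ (2 + R + v) = entryVal I.encode μ I.m I.n I.p R v j) :
    I.IsTable (fun v => μ (2 + v) - I.p) (fun k => μ (2 + (I.m + k)) - I.p)
      (fun k => μ (2 + (I.m + I.p + k)) - I.p)
      (fun a v => I.encode (3 + I.m * I.m + I.m * a + v)) (fun v => μ (2 + R + v)) := by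
  classical
  have hmem : ∀ j k, k ∈ children I.n I.p (fun k => μ (2 + (I.m + k)) - I.p) j ↔
      k < I.p ∧ I.n ≤ k ∧ μ (2 + (I.m + k)) = I.p + j := fun j k => by
    rw [mem_children]
    refine and_congr_right fun hk => and_congr_right fun _ => ?_
    have := hge (I.m + k) (by omega)
    omega
  have hchild : ∀ j, (Finset.range I.p).filter (fun k => I.n ≤ k ∧ μ (2 + (I.m + k)) = I.p + j) =
      children I.n I.p (fun k => μ (2 + (I.m + k)) - I.p) j := fun j => by
    ext k
    rw [hmem]
    simp
  have hcol : ∀ v : Fin I.m, μ (2 + v) = I.p + (μ (2 + v) - I.p) := fun v => by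
    have := hge v (by omega)
    omega
  have hW : ∀ v : Fin I.m, μ (2 + v) - I.p < I.p → μ (2 + R + v) = _ := fun v hv =>
    (hent v v.2 _ hv (hcol v)).trans
      (loop_combine _ (fun k => I.n ≤ k ∧ μ (2 + (I.m + k)) = I.p + (μ (2 + v) - I.p)) _ _ (by omega))
  have hbest : ∀ (v w : Fin I.m) (k : ℕ), I.G.Adj v w → μ (2 + w) - I.p = k →
      μ (2 + R + w) ≤ bestVal I.encode μ I.m I.p R v k := fun v w k hvw hk => by
    refine le_loop_max I.m (fun w => μ (2 + w) = I.p + k ∧ 0 < I.encode (3 + I.m * v + w))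
      (fun w => μ (2 + R + w)) w w.2 ⟨?_, ?_⟩
    · rw [hcol w, hk]
    · rw [encode_adj, if_pos hvw]
      exact one_pos
  have hbest' : ∀ (v : Fin I.m) (k : ℕ), 0 < bestVal I.encode μ I.m I.p R v k → ∃ w : Fin I.m,
      I.G.Adj v w ∧ μ (2 + w) - I.p = k ∧ μ (2 + R + w) = bestVal I.encode μ I.m I.p R v k := by
    intro v k hpos
    obtain ⟨w, hw, ⟨h1, h2⟩, h3⟩ := exists_loop_max I.m
      (fun w => μ (2 + w) = I.p + k ∧ 0 < I.encode (3 + I.m * v + w))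
      (fun w => μ (2 + R + w)) hpos
    refine ⟨⟨w, hw⟩, ?_, by simp only; omega, h3⟩
    have h4 := encode_adj I v ⟨w, hw⟩
    by_contra hn
    rw [if_neg hn] at h4
    simp only at h4
    omega
  constructor
  · intro v hv hpos
    have hv' := hW v hv
    split_ifs at hv' with hall
    · rw [hchild] at hv'
      have hg : ∀ k, ∃ w : Fin I.m, k ∈ children I.n I.p (fun k => μ (2 + (I.m + k)) - I.p)
          (μ (2 + v) - I.p) → I.G.Adj v w ∧ μ (2 + w) - I.p = k ∧
          μ (2 + R + w) = bestVal I.encode μ I.m I.p R v k ∧ 0 < μ (2 + R + w) := fun k => by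
        by_cases hk : k ∈ children I.n I.p (fun k => μ (2 + (I.m + k)) - I.p) (μ (2 + v) - I.p)
        · have hk' := (hmem _ _).1 hk
          have hb := hall k hk'.1 hk'.2
          obtain ⟨w, h1, h2, h3⟩ := hbest' v k hb
          exact ⟨w, fun _ => ⟨h1, h2, h3, by omega⟩⟩
        · exact ⟨v, fun h => absurd h hk⟩
      choose g hg using hg
      refine ⟨g, fun k hk => ⟨(hg k hk).1, (hg k hk).2.1, (hg k hk).2.2.2⟩, ?_⟩
      rw [hv']
      refine Nat.add_le_add_left (Finset.sum_le_sum fun k hk => ?_) _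
      rw [(hg k hk).2.2.1]
    · omega
  · intro v hv g hg
    have hv' := hW v hv
    dsimp only [IsChoice] at hg
    have hle : ∀ k ∈ children I.n I.p (fun k => μ (2 + (I.m + k)) - I.p) (μ (2 + v) - I.p),
        μ (2 + R + g k) ≤ bestVal I.encode μ I.m I.p R v k := fun k hk =>
      hbest v (g k) k (hg k hk).1 (hg k hk).2.1
    rw [if_pos, hchild] at hv'
    · rw [hv']
      exact Nat.add_le_add_left (Finset.sum_le_sum fun k hk => Nat.sub_le_sub_right (hle k hk) 1) _
    · intro k hk hP
      have hk' := (hmem (μ (2 + v) - I.p) k).2 ⟨hk, hP⟩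
      exact (hg k hk').2.2.trans_le (hle k hk')

theorem sum_encode_u (I : ICFDInstance) (i : Fin I.n) :
    ∑ v ∈ Finset.range I.m, I.encode (3 + I.m * I.m + I.m * i + v) = I.value i Finset.univ := by
  rw [value, Finset.sum_range]
  exact Finset.sum_congr rfl fun v _ => encode_u I i v

/-- The samples describe a forest of slots and table entries suffice for all agents. -/
def Passes (I : ICFDInstance) (R : ℕ) (μ : ℕ → ℕ) : Prop :=
  ∀ j < I.p, if j < I.n then μ (2 + (I.m + I.p + j)) = I.p + j ∧
      ∃ w < I.m, μ (2 + w) = I.p + j ∧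
        ∑ v ∈ Finset.range I.m, I.encode (3 + I.m * I.m + I.m * j + v) + I.n ≤
          I.n * μ (2 + R + w)
    else μ (2 + (I.m + j)) < I.p + j ∧ μ (2 + (I.m + I.p + j)) =
      μ (2 + (I.m + I.p + (μ (2 + (I.m + j)) - I.p)))

/-- Soundness: the check itself establishes the forest property on which the validity of the table
depends. -/
theorem Passes.isYesPROP {I : ICFDInstance} {R : ℕ} {μ : ℕ → ℕ} (h : I.Passes R μ)
    (hnp : I.n ≤ I.p) (hR : I.m + (I.p + I.p) ≤ R) (hge : ∀ x < R, I.p ≤ μ (2 + x))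
    (hent : (∀ k, I.n ≤ k → k < I.p → μ (2 + (I.m + k)) < I.p + k) →
      ∀ v < I.m, ∀ j < I.p, μ (2 + v) = I.p + j →
        μ (2 + R + v) = entryVal I.encode μ I.m I.n I.p R v j) : I.IsYesPROP := by
  have hnode : ∀ j, I.n ≤ j → j < I.p → μ (2 + (I.m + j)) < I.p + j ∧
      μ (2 + (I.m + I.p + j)) = μ (2 + (I.m + I.p + (μ (2 + (I.m + j)) - I.p))) :=
    fun j hj hjp => by simpa [not_lt.2 hj] using h j hjp
  have hroot : ∀ j < I.n, _ := fun j hj => by simpa only [hj, if_true] using h j (by omega)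
  refine (I.isTable_of_entryVal μ R hR hge (hent fun k h1 h2 => (hnode k h1 h2).1)).isYesPROP
    ⟨fun i hi => ?_, fun j h1 h2 => ?_, fun j h1 h2 => ?_⟩ hnp (fun i => funext fun v => ?_)
    fun i => ?_
  · rw [(hroot i hi).1]
    omega
  · have := (hnode j h1 h2).1
    have := hge (I.m + j) (by omega)
    omega
  · rw [(hnode j h1 h2).2]
  · exact encode_u I i v
  · obtain ⟨w, hw, h1, h2⟩ := (hroot i i.2).2
    rw [sum_encode_u] at h2
    exact ⟨⟨w, hw⟩, by simp only; omega, h2⟩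

/-- Completeness: only `3 p` samples are prescribed. The colours of all other vertices are free,
since additional candidates can only raise the maxima in the table. -/
theorem passes_of_pattern {I : ICFDInstance} {R : ℕ} {μ : ℕ → ℕ} {π : Fin I.n → Finset (Fin I.m)}
    (hprop : I.IsProportional π) (hnp : I.n ≤ I.p) (hR : I.m + (I.p + I.p) ≤ R)
    (hge : ∀ x < R, I.p ≤ μ (2 + x))
    (hent : (∀ k, I.n ≤ k → k < I.p → μ (2 + (I.m + k)) < I.p + k) →
      ∀ v < I.m, ∀ j < I.p, μ (2 + v) = I.p + j →
        μ (2 + R + v) = entryVal I.encode μ I.m I.n I.p R v j)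
    {f : ℕ → Fin I.m} {par ag : ℕ → ℕ} (hF : IsForest I.n I.p par ag)
    (hadj : ∀ j, I.n ≤ j → j < I.p → I.G.Adj (f (par j)) (f j))
    (hval : ∀ i : Fin I.n, ∑ j ∈ slots I.p ag i, I.u i (f j) = I.value i (π i))
    (hcol : ∀ j < I.p, μ (2 + f j) = I.p + j)
    (hpar : ∀ j < I.p, μ (2 + (I.m + j)) = I.p + par j)
    (hag : ∀ j < I.p, μ (2 + (I.m + I.p + j)) = I.p + ag j) : I.Passes R μ := by
  have hlt : ∀ k, I.n ≤ k → k < I.p → μ (2 + (I.m + k)) < I.p + k := fun k h1 h2 => by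
    rw [hpar k h2]
    have := hF.par_lt k h1 h2
    omega
  have hag' : ∀ j < I.p, μ (2 + (I.m + I.p + j)) - I.p = ag j := fun j hj => by
    rw [hag j hj]
    omega
  have hpar' : ∀ j < I.p, μ (2 + (I.m + j)) - I.p = par j := fun j hj => by
    rw [hpar j hj]
    omega
  have hF' : IsForest I.n I.p (fun k => μ (2 + (I.m + k)) - I.p)
      (fun k => μ (2 + (I.m + I.p + k)) - I.p) := by
    refine ⟨fun i hi => ?_, fun j h1 h2 => ?_, fun j h1 h2 => ?_⟩
    · rw [hag' i (by omega), hF.root i hi]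
    · rw [hpar' j h2]
      exact hF.par_lt j h1 h2
    · have := hF.par_lt j h1 h2
      rw [hpar' j h2, hag' _ (by omega), hag' j h2, hF.ag_par j h1 h2]
  have hsum := (I.isTable_of_entryVal μ R hR hge (hent hlt)).sum_le hF' hnp f
    (fun j hj => by rw [hcol j hj]; omega)
    (fun j h1 h2 => by
      rw [hpar' j h2]
      exact hadj j h1 h2)
  have hslots : ∀ i, slots I.p (fun k => μ (2 + (I.m + I.p + k)) - I.p) i = slots I.p ag i :=
    fun i => Finset.filter_congr fun k hk => by
      simp only [hag' k (Finset.mem_range.1 hk)]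
  intro j hj
  split_ifs with hjn
  · refine ⟨by rw [hag j hj, hF.root j hjn], f j, (f j).2, hcol j hj, ?_⟩
    have h1 := hsum j hjn
    rw [hslots] at h1
    have h2 : 1 + I.value ⟨j, hjn⟩ (π ⟨j, hjn⟩) ≤ μ (2 + R + f j) := by
      rw [← hval ⟨j, hjn⟩]
      refine le_trans (le_of_eq ?_) h1
      congr 1
      exact Finset.sum_congr rfl fun k _ => (encode_u I ⟨j, hjn⟩ (f k)).symm
    have h3 := hprop ⟨j, hjn⟩
    have hn : (0 : ℚ) < I.n := by exact_mod_cast Nat.zero_lt_of_lt hjn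
    rw [div_le_iff₀ hn] at h3
    have h4 : I.value ⟨j, hjn⟩ Finset.univ ≤ I.value ⟨j, hjn⟩ (π ⟨j, hjn⟩) * I.n := by
      exact_mod_cast h3
    have h5 := sum_encode_u I ⟨j, hjn⟩
    simp only at h5
    rw [h5]
    have h6 := Nat.mul_le_mul_left I.n h2
    rw [Nat.mul_add] at h6
    rw [Nat.mul_comm] at h4
    omega
  · have := hF.par_lt j (by omega) hj
    refine ⟨hlt j (by omega) hj, ?_⟩
    rw [hpar' j hj, hag j hj, hag _ (by omega), hF.ag_par j (by omega) hj]

end ICFDInstance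

/-! ### Outcome of one round and of all rounds. -/

namespace RAM

/-- The memory `μ` holds the samples of a round that starts with coin `c`, and, provided that the
samples describe a forest, the table for them. -/
structure IsOutcome (I : ICFDInstance) (R : ℕ) (ω : ℕ → Bool) (c : ℕ) (μ : ℕ → ℕ) : Prop where
  samples : ∀ j < R, μ (2 + j) = sample ω I.p (c + j * I.p)
  table : (∀ k, I.n ≤ k → k < I.p → μ (2 + (I.m + k)) < I.p + k) →
    ∀ v < I.m, ∀ j < I.p, μ (2 + v) = I.p + j →
      μ (2 + R + v) = entryVal I.encode μ I.m I.n I.p R v j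

theorem IsOutcome.p_le {I : ICFDInstance} {R : ℕ} {ω : ℕ → Bool} {c : ℕ} {μ : ℕ → ℕ}
    (h : IsOutcome I R ω c μ) (x : ℕ) (hx : x < R) : I.p ≤ μ (2 + x) := by
  rw [h.samples x hx]
  exact le_sample ω I.p _

/-- The witness is the memory just before the final store, which touches only the counter in cell
`0`, outside the samples and the table. -/
theorem Cmd.exec_round (I : ICFDInstance) (ω : ℕ → Bool) (env : ℕ → ℕ)
    (σ : (ℕ → ℕ) × ℕ) {R : ℕ} (hm : env 0 = I.m) (hn : env 1 = I.n) (hp : env 2 = I.p)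
    (hr : env 3 = R) (hR : I.m + (I.p + I.p) ≤ R) :
    ∃ μ : ℕ → ℕ, IsOutcome I R ω σ.2 μ ∧
      (round.exec I.encode ω 6 env σ).2 = σ.2 + R * I.p ∧
      (I.Passes R μ → (round.exec I.encode ω 6 env σ).1 0 = σ.1 0 + 1) ∧
      (¬ I.Passes R μ → (round.exec I.encode ω 6 env σ).1 0 = σ.1 0) := by
  obtain ⟨d1, d2, d3⟩ := exec_draw I.encode ω env σ
  obtain ⟨f1, f2, f3⟩ := exec_fill I.encode ω env (draw.exec I.encode ω 6 env σ) hm hn hp hr hR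
  set τ := draw.exec I.encode ω 6 env σ
  set τ' := fill.exec I.encode ω 6 env τ
  rw [hp, hr] at d1
  rw [hp, hr] at d3
  have hround : round.exec I.encode ω 6 env σ = (Function.update τ'.1 0
      (τ'.1 0 + Ex.check.eval I.encode τ'.1 6 env), τ'.2) := rfl
  refine ⟨τ'.1, ⟨fun j hj => ?_, fun hF v hv j hj hc => ?_⟩, ?_, fun h => ?_, fun h => ?_⟩
  · rw [f2 _ (by omega), d3 j hj]
  · refine f3 (fun k h1 h2 => ?_) v hv j hj ?_
    · rw [← f2 _ (by omega)]
      exact hF k h1 h2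
    · rw [← f2 _ (by omega), hc]
  · rw [hround, ← d1, ← f1]
  all_goals
    unfold ICFDInstance.Passes at h
    rw [hround]
    dsimp only
    rw [Function.update_self, f2 0 (by omega), d2, Ex.eval_check, hm, hn, hp, hr]
  · rw [if_pos h]
  · rw [if_neg h, Nat.add_zero]

/-- The rounds succeed only if some round passes the check, and they do if some round is certain to
pass it. -/
theorem Cmd.exec_rounds (I : ICFDInstance) (ω : ℕ → Bool) (env : ℕ → ℕ) {R N : ℕ}
    (hm : env 0 = I.m) (hn : env 1 = I.n) (hp : env 2 = I.p) (hr : env 3 = R) (hN : env 4 = N)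
    (hR : I.m + (I.p + I.p) ≤ R) :
    ((Cmd.exec I.encode ω (.loop 4 .round) 5 env (fun _ => 0, 0)).1 0 ≠ 0 →
      ∃ c μ, IsOutcome I R ω c μ ∧ I.Passes R μ) ∧
    ((∃ t < N, ∀ μ, IsOutcome I R ω (t * (R * I.p)) μ → I.Passes R μ) →
      (Cmd.exec I.encode ω (.loop 4 .round) 5 env (fun _ => 0, 0)).1 0 ≠ 0) := by
  rw [Cmd.exec, hN]
  have key := loop_induction (n := N) (x := ((fun _ => 0, 0) : (ℕ → ℕ) × ℕ))
    (f := fun k σ => round.exec I.encode ω (5 + 1) (Function.update env 5 k) σ)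
    -- The memory of a round also depends on earlier rounds; quantifying over every outcome `μ`
    -- turns success into an event in the coins of round `t` alone.
    (fun T σ => σ.2 = T * (R * I.p) ∧
      (σ.1 0 ≠ 0 → ∃ c μ, IsOutcome I R ω c μ ∧ I.Passes R μ) ∧
      ((∃ t < T, ∀ μ, IsOutcome I R ω (t * (R * I.p)) μ → I.Passes R μ) → σ.1 0 ≠ 0))
    (by simp) ?_
  · exact key.2
  · rintro k hk σ ⟨h1, h2, h3⟩
    obtain ⟨μ, o1, o2, o3, o4⟩ := exec_round I ω (Function.update env 5 k) σ (R := R)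
      (by simpa using hm) (by simpa using hn) (by simpa using hp) (by simpa using hr) hR
    refine ⟨o2.trans (by rw [h1]; ring), fun hne => ?_, ?_⟩
    · by_cases hpass : I.Passes R μ
      · exact ⟨_, μ, o1, hpass⟩
      · exact h2 ((o4 hpass) ▸ hne)
    · rintro ⟨t, ht, hall⟩
      by_cases hpass : I.Passes R μ
      · rw [o3 hpass]
        omega
      · rw [o4 hpass]
        rcases (by omega : t = k ∨ t < k) with rfl | hlt
        · exact absurd (hall μ (h1 ▸ o1)) hpass
        · exact h3 ⟨t, hlt, hall⟩

/-- For a yes-instance, some round succeeds with probability at least `1 - 1 / e`. -/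
theorem le_coinMeasure_exists_round (I : ICFDInstance) (h : I.IsYesPROP) {R : ℕ}
    (hR : I.m + (I.p + I.p) = R) :
    1 - 1 / Real.exp 1 ≤ coinMeasure.real {ω | ∃ t < (2 * I.p) ^ (3 * I.p),
      ∀ μ, IsOutcome I R ω (t * (R * I.p)) μ → I.Passes R μ} := by
  obtain ⟨π, hπ, hprop⟩ := h
  have hnp := hπ.n_le_p
  obtain ⟨f, par, ag, hF, hpar, hinj, hadj, hval⟩ := hπ.exists_forest
  let inv : ℕ → ℕ := Function.invFunOn (fun j => (f j : ℕ)) (Set.Iio I.p)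
  have hinv : ∀ j < I.p, inv (f j) = j := fun j hj => by
    have hinj' : Set.InjOn (fun j => (f j : ℕ)) (Set.Iio I.p) := fun a ha b hb hab =>
      hinj ha hb (Fin.ext hab)
    exact hinj'.leftInvOn_invFunOn hj
  -- On unused vertices `inv` is arbitrary; `y` matters only on the set `J` of prescribed samples.
  let y : ℕ → ℕ := fun x => if x < I.m then I.p + inv x else
    if x < I.m + I.p then I.p + par (x - I.m) else I.p + ag (x - (I.m + I.p))
  have y1 : ∀ j < I.p, y (f j) = I.p + j := fun j hj => by simp [y, hinv j hj]
  have y2 : ∀ j < I.p, y (I.m + j) = I.p + par j := fun j hj => by simp [y, hj]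
  have y3 : ∀ j < I.p, y (I.m + I.p + j) = I.p + ag j := fun j hj => by
    simp only [y]
    rw [if_neg (by omega), if_neg (by omega), Nat.add_sub_cancel_left]
  let J : Finset ℕ := (Finset.range I.p).image (fun j => (f j : ℕ)) ∪
    ((Finset.range I.p).image (I.m + ·) ∪ (Finset.range I.p).image (I.m + I.p + ·))
  have hJ : ∀ s, s ∈ J ↔ ∃ j < I.p, s = f j ∨ s = I.m + j ∨ s = I.m + I.p + j := fun s => by
    simp only [J, Finset.mem_union, Finset.mem_image, Finset.mem_range, eq_comm (a := s)]
    simp only [← exists_or, ← and_or_left]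
  have hcard : J.card ≤ 3 * I.p := by
    have h1 := Finset.card_image_le (s := Finset.range I.p) (f := fun j => (f j : ℕ))
    have h2 := Finset.card_image_le (s := Finset.range I.p) (f := (I.m + ·))
    have h3 := Finset.card_image_le (s := Finset.range I.p) (f := (I.m + I.p + ·))
    rw [Finset.card_range] at h1 h2 h3
    refine (Finset.card_union_le _ _).trans ?_
    have := Finset.card_union_le ((Finset.range I.p).image (I.m + ·))
      ((Finset.range I.p).image (I.m + I.p + ·))
    omega
  refine (le_coinMeasure_exists_samples I.p R I.one_le_p J ?_ hcard y ?_).trans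
    (MeasureTheory.measureReal_mono ?_)
  · intro s hs
    obtain ⟨j, hj, rfl | rfl | rfl⟩ := (hJ s).1 hs <;> omega
  · intro s hs
    obtain ⟨j, hj, rfl | rfl | rfl⟩ := (hJ s).1 hs
    · rw [y1 j hj]; omega
    · rw [y2 j hj]
      have := hpar j hj
      omega
    · rw [y3 j hj]
      have := hF.ag_lt j hj
      omega
  · rintro ω ⟨t, ht, hω⟩
    refine ⟨t, ht, fun μ hμ => ICFDInstance.passes_of_pattern hprop hnp hR.le hμ.p_le hμ.table
      hF hadj hval (fun j hj => ?_) (fun j hj => ?_) (fun j hj => ?_)⟩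
    · rw [hμ.samples _ (by omega), hω _ ((hJ _).2 ⟨j, hj, .inl rfl⟩), y1 j hj]
    · rw [hμ.samples _ (by omega), hω _ ((hJ _).2 ⟨j, hj, .inr (.inl rfl)⟩), y2 j hj]
    · rw [hμ.samples _ (by omega), hω _ ((hJ _).2 ⟨j, hj, .inr (.inr rfl)⟩), y3 j hj]

end RAM

/-! ### Running time -/

namespace RAM

/-- This permits replacing all loop bounds by one common upper bound, so that costs become
polynomials in a single variable. -/
theorem Ex.cost_mono {B B' : ℕ → ℕ} {q : ℕ} (hB : ∀ i < q, B i ≤ B' i) (e : Ex) :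
    ∀ d, e.wf q d = true → e.cost B ≤ e.cost B' := by
  induction e with
  | const | var => exact fun _ _ => le_rfl
  | add a b iha ihb | sub a b iha ihb =>
    intro d hw
    simp only [Ex.wf, Bool.and_eq_true] at hw
    have := iha d hw.1
    have := ihb d hw.2
    simp only [Ex.cost]
    omega
  | load a iha | read a iha =>
    intro d hw
    have := iha d hw
    simp only [Ex.cost]
    omega
  | ifLt a b x y iha ihb ihx ihy =>
    intro d hw
    simp only [Ex.wf, Bool.and_eq_true] at hw
    have := iha d hw.1.1.1
    have := ihb d hw.1.1.2
    have := ihx d hw.1.2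
    have := ihy d hw.2
    simp only [Ex.cost]
    omega
  | fold i init body ihi ihb =>
    intro d hw
    simp only [Ex.wf, Bool.and_eq_true, decide_eq_true_eq] at hw
    simp only [Ex.cost]
    gcongr
    · exact ihi d hw.1.2
    · exact hB i hw.1.1
    · exact ihb (d + 2) hw.2

theorem Cmd.cost_mono {B B' : ℕ → ℕ} {q : ℕ} (hB : ∀ i < q, B i ≤ B' i) (c : Cmd) :
    ∀ d, c.wf q d = true → c.cost B ≤ c.cost B' := by
  induction c with
  | skip => exact fun _ _ => le_rfl
  | store a v =>
    intro d hw
    simp only [Cmd.wf, Bool.and_eq_true] at hw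
    have := a.cost_mono hB d hw.1
    have := v.cost_mono hB d hw.2
    simp only [Cmd.cost]
    omega
  | flip a =>
    intro d hw
    have := a.cost_mono hB d hw
    simp only [Cmd.cost]
    omega
  | seq c c' ih ih' =>
    intro d hw
    simp only [Cmd.wf, Bool.and_eq_true] at hw
    have := ih d hw.1
    have := ih' d hw.2
    simp only [Cmd.cost]
    omega
  | ifLt a b c c' ih ih' =>
    intro d hw
    simp only [Cmd.wf, Bool.and_eq_true] at hw
    have := a.cost_mono hB d hw.1.1.1
    have := b.cost_mono hB d hw.1.1.2
    have := ih d hw.1.2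
    have := ih' d hw.2
    simp only [Cmd.cost]
    omega
  | loop i body ih =>
    intro d hw
    simp only [Cmd.wf, Bool.and_eq_true, decide_eq_true_eq] at hw
    simp only [Cmd.cost]
    gcongr
    · exact hB i hw.1
    · exact ih (d + 1) hw.2

/-- Functions with a polynomial bound. -/
def PolyBounded (f : ℕ → ℕ) : Prop := ∃ K b, ∀ x, 1 ≤ x → f x ≤ K * x ^ b

namespace PolyBounded

theorem const (c : ℕ) : PolyBounded fun _ => c := ⟨c, 0, fun x _ => by simp⟩

theorem id : PolyBounded fun x => x := ⟨1, 1, fun x _ => by simp⟩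

theorem add {f g : ℕ → ℕ} (hf : PolyBounded f) (hg : PolyBounded g) :
    PolyBounded fun x => f x + g x := by
  obtain ⟨K, b, hf⟩ := hf
  obtain ⟨K', b', hg⟩ := hg
  refine ⟨K + K', b + b', fun x hx => ?_⟩
  have h1 := (hf x hx).trans
    (Nat.mul_le_mul_left K (Nat.pow_le_pow_right hx (Nat.le_add_right b b')))
  have h2 := (hg x hx).trans
    (Nat.mul_le_mul_left K' (Nat.pow_le_pow_right hx (Nat.le_add_left b' b)))
  rw [Nat.add_mul]
  exact Nat.add_le_add h1 h2

theorem mul {f g : ℕ → ℕ} (hf : PolyBounded f) (hg : PolyBounded g) :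
    PolyBounded fun x => f x * g x := by
  obtain ⟨K, b, hf⟩ := hf
  obtain ⟨K', b', hg⟩ := hg
  refine ⟨K * K', b + b', fun x hx => (Nat.mul_le_mul (hf x hx) (hg x hx)).trans (le_of_eq ?_)⟩
  ring

end PolyBounded

theorem Ex.polyBounded_cost (e : Ex) : PolyBounded fun x => e.cost fun _ => x := by
  induction e with
  | const | var => exact .const _
  | add a b iha ihb | sub a b iha ihb => exact (iha.add ihb).add (.const 1)
  | load a iha | read a iha => exact iha.add (.const 1)
  | ifLt a b x y iha ihb ihx ihy => exact (((iha.add ihb).add ihx).add ihy).add (.const 1)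
  | fold i init body ihi ihb => exact (ihi.add (.mul .id (ihb.add (.const 5)))).add (.const 6)

theorem Cmd.polyBounded_cost (c : Cmd) : PolyBounded fun x => c.cost fun _ => x := by
  induction c with
  | skip => exact .const _
  | store a v => exact (a.polyBounded_cost.add v.polyBounded_cost).add (.const 1)
  | flip a => exact a.polyBounded_cost.add (.const 2)
  | seq c c' ih ih' => exact ih.add ih'
  | ifLt a b c c' ih ih' =>
    exact (((a.polyBounded_cost.add b.polyBounded_cost).add ih).add ih').add (.const 1)
  | loop i body ih => exact (PolyBounded.mul .id (ih.add (.const 3))).add (.const 2)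

/-! ### The run of the whole program. -/

theorem Program.reaches_bind {inp : ℕ → ℕ} {ω : ℕ → Bool} {d q : ℕ} {e : Ex} {s : State}
    {env : ℕ → ℕ} (B : ℕ → ℕ) (hw : e.wf q d = true) (hq : q ≤ d)
    (hs : ∀ i < d, s.reg (2 * i) = env i) (hB : ∀ i < q, env i = B i) :
    Reaches inp ω (.bind d e) s (e.cost B + 2) fun s' => s'.mem = s.mem ∧ s'.coins = s.coins ∧
      ∀ i < d + 1, s'.reg (2 * i) = Function.update env d (e.eval inp s.mem d env) i := by
  refine .seq ((e.reaches_compile inp ω q B d 0 env s hw hq hs hB).mono le_rfl fun s₁ h₁ =>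
    .move (by omega) fun s₂ hm hc hr => ⟨hm.trans h₁.mem, hc.trans h₁.coins, fun i hi => ?_⟩)
  rw [hr]
  rcases (by omega : i = d ∨ i < d) with rfl | hlt
  · rw [Function.update_self, Function.update_self]
    exact h₁.value
  · rw [Function.update_of_ne (by omega), Function.update_of_ne (by omega), h₁.var i hlt, hs i hlt]

/-- The values of the variables `0, …, 4`. -/
def globals (I : ICFDInstance) : ℕ → ℕ
  | 0 => I.m
  | 1 => I.n
  | 2 => I.p
  | 3 => I.m + (I.p + I.p)
  | 4 => (2 * I.p) ^ (3 * I.p)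
  | _ => 0

/-- A bound on the number of steps of the algorithm. -/
def steps (I : ICFDInstance) : ℕ :=
  14 + if I.n ≤ I.p then
    16 + Ex.rounds.cost (globals I) + Cmd.cost (globals I) (.loop 4 .round) else 0

theorem reaches_algorithm (I : ICFDInstance) (ω : ℕ → Bool) :
    Reaches I.encode ω algorithm State.init (steps I) fun s =>
      s.reg 0 = if I.n ≤ I.p then
        (Cmd.exec I.encode ω (.loop 4 .round) 5 (globals I) (fun _ => 0, 0)).1 0 else 0 := by
  have hstep : ∀ {d q : ℕ} {e : Ex} {s : State} {Q : State → Prop}, e.wf q d = true → q ≤ d →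
      s.mem = (fun _ => 0) → s.coins = 0 → (∀ i < d, s.reg (2 * i) = globals I i) →
      e.eval I.encode (fun _ => 0) d (globals I) = globals I d →
      (∀ s' : State, s'.mem = (fun _ => 0) → s'.coins = 0 →
        (∀ i < d + 1, s'.reg (2 * i) = globals I i) → Q s') →
      Reaches I.encode ω (.bind d e) s (e.cost (globals I) + 2) Q := by
    intro d q e s Q hw hq hm hc hs he hQ
    refine (Program.reaches_bind (globals I) hw hq hs fun _ _ => rfl).mono le_rfl
      fun s' h => hQ s' (h.1.trans hm) (h.2.1.trans hc) fun i hi => ?_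
    rw [h.2.2 i hi, hm, he, Function.update_eq_self]
  -- Each of the three bindings takes 4 steps; the rest is the test and both branches.
  refine .mono (T := 4 + (4 + (4 + (1 + (if I.n ≤ I.p then 16 + Ex.rounds.cost (globals I) +
    Cmd.cost (globals I) (.loop 4 .round) else 0) + 1)))) ?_ (by unfold steps; omega) fun _ h => h
  refine .seq (hstep (q := 0) rfl le_rfl rfl rfl (by simp) rfl fun s₁ m₁ c₁ r₁ => ?_)
  refine .seq (hstep (q := 0) rfl (by omega) m₁ c₁ r₁ rfl fun s₂ m₂ c₂ r₂ => ?_)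
  refine .seq (hstep (q := 0) rfl (by omega) m₂ c₂ r₂ rfl fun s₃ m₃ c₃ r₃ => ?_)
  have hn : s₃.reg 2 = I.n := r₃ 1 (by omega)
  have hp : s₃.reg 4 = I.p := r₃ 2 (by omega)
  refine .ifLt (fun hlt => .const ?_) fun hlt => ?_
  · rw [hn, hp] at hlt
    rw [if_neg (by omega), State.setReg_reg, Function.update_self]
  · rw [hn, hp, not_lt] at hlt
    simp only [if_pos hlt]
    refine .mono (T := (8 + 2) + ((Ex.rounds.cost (globals I) + 2) +
      (Cmd.cost (globals I) (.loop 4 .round) + (2 + 2)))) ?_ (by omega) fun _ h => h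
    refine .seq (hstep (q := 0) rfl (by omega) m₃ c₃ r₃ rfl fun s₄ m₄ c₄ r₄ => ?_)
    refine .seq (hstep (q := 3) rfl (by omega) m₄ c₄ r₄
      (Ex.eval_rounds _ _ _) fun s₅ m₅ c₅ r₅ => ?_)
    refine .seq ((Cmd.reaches_compile I.encode ω 5 (globals I) (.loop 4 .round) 5 (globals I) s₅
      rfl le_rfl r₅ fun _ _ => rfl).mono le_rfl fun s₆ h₆ => ?_)
    refine .seq ((Ex.reaches_compile I.encode ω 0 (globals I) (.load (.const 0)) 5 0 (globals I) s₆
      rfl (by omega) (fun i hi => (h₆.var i hi).trans (r₅ i hi)) fun _ _ => rfl).mono le_rfl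
      fun s₇ h₇ => .move (by omega) fun s₈ m₈ c₈ r₈ => ?_)
    have h7 : s₇.reg 1 = s₆.mem 0 := h₇.value
    rw [r₈, Function.update_self, h7, show s₆.mem = _ from congrArg Prod.fst h₆.effect, m₅, c₅]

theorem Reaches.accepts_iff {inp : ℕ → ℕ} {ω : ℕ → Bool} {P : Program} {T x : ℕ}
    (h : Reaches inp ω P State.init T fun s => s.reg 0 = x) : Accepts P inp ω ↔ x ≠ 0 := by
  obtain ⟨t, s, hx, -, rfl⟩ := h
  refine ⟨fun ⟨t', s', hx', hne⟩ => ?_, fun hne => ⟨t, s, hx, hne⟩⟩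
  rwa [(hx.unique hx').2]

/-- After the test `n ≤ p`, all loop bounds within a round are at most `3 m`, attained by `m + 2 p`
when `p = m`. Only the number of rounds is exponential, and it enters as a factor. -/
theorem exists_steps_le : ∃ K b : ℕ, ∀ I : ICFDInstance,
    steps I ≤ K * I.m ^ b * (2 * I.p) ^ (3 * I.p) := by
  -- The constant collects `14 + 16 + 2` steps of overhead and `3` per round.
  obtain ⟨K, b, h⟩ := ((PolyBounded.const 35).add (Ex.rounds.polyBounded_cost)).add
    Cmd.round.polyBounded_cost
  refine ⟨K * 3 ^ b, b, fun I => ?_⟩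
  have hp := I.one_le_p
  have hpm := I.p_le_m
  have h3 := h (3 * I.m) (by omega)
  beta_reduce at h3
  have hN : 1 ≤ (2 * I.p) ^ (3 * I.p) := Nat.one_le_pow _ _ (by omega)
  have h4 : Cmd.cost (globals I) (.loop 4 .round) =
      (2 * I.p) ^ (3 * I.p) * (Cmd.round.cost (globals I) + 3) + 2 := rfl
  rw [steps, h4, mul_assoc K, ← mul_pow]
  generalize (2 * I.p) ^ (3 * I.p) = N at hN ⊢
  split_ifs with hnp
  · have hB : ∀ i < 4, globals I i ≤ 3 * I.m := fun i hi => by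
      interval_cases i <;> simp only [globals] <;> omega
    have h1 := Ex.rounds.cost_mono (B' := fun _ => 3 * I.m) hB 4 rfl
    have h2 := Cmd.round.cost_mono (B' := fun _ => 3 * I.m) hB 6 rfl
    calc 14 + (16 + Ex.rounds.cost (globals I) + (N * (Cmd.round.cost (globals I) + 3) + 2))
        ≤ N * (32 + Ex.rounds.cost (globals I)) + N * (Cmd.round.cost (globals I) + 3) := by
          have := Nat.mul_le_mul_right (32 + Ex.rounds.cost (globals I)) hN
          omega
      _ = (35 + Ex.rounds.cost (globals I) + Cmd.round.cost (globals I)) * N := by ring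
      _ ≤ K * (3 * I.m) ^ b * N := Nat.mul_le_mul_right _ (by omega)
  · have := Nat.mul_le_mul (by omega : 14 ≤ K * (3 * I.m) ^ b) hN
    omega

/-- For `p ≥ 3` both `2 p ≤ p²` and `ln p ≥ 1` hold. The cases `p = 1`, where the power is `1`, and
`p = 2` are absorbed by the constant `4096 = 4 ^ 6`, the number of rounds for `p = 2`. -/
theorem rounds_le (p : ℕ) (hp : 1 ≤ p) :
    (((2 * p) ^ (3 * p) : ℕ) : ℝ) ≤ 4096 * (p : ℝ) ^ ((6 : ℕ) * (p * Real.log p)) := by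
  have hp1 : (1 : ℝ) ≤ p := by exact_mod_cast hp
  have hlog : 0 ≤ Real.log p := Real.log_nonneg hp1
  have hone : 1 ≤ (p : ℝ) ^ ((6 : ℕ) * (p * Real.log p)) :=
    Real.one_le_rpow hp1 (by positivity)
  rcases (by omega : p = 1 ∨ p = 2 ∨ 3 ≤ p) with rfl | rfl | h3
  · norm_num
  · norm_num at hone ⊢
    linarith
  · have hlog1 : 1 ≤ Real.log p := by
      rw [Real.le_log_iff_exp_le (by positivity)]
      have : (3 : ℝ) ≤ p := by exact_mod_cast h3
      linarith [Real.exp_one_lt_three]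
    have h1 : (2 * p) ^ (3 * p) ≤ p ^ (6 * p) := by
      calc (2 * p) ^ (3 * p) ≤ (p ^ 2) ^ (3 * p) := Nat.pow_le_pow_left (by nlinarith) _
        _ = p ^ (6 * p) := by rw [← pow_mul]; ring_nf
    calc (((2 * p) ^ (3 * p) : ℕ) : ℝ) ≤ ((p ^ (6 * p) : ℕ) : ℝ) := by exact_mod_cast h1
      _ = (p : ℝ) ^ (((6 * p : ℕ)) : ℝ) := by rw [Real.rpow_natCast]; push_cast; rfl
      _ ≤ (p : ℝ) ^ ((6 : ℕ) * (p * Real.log p)) := by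
        refine Real.rpow_le_rpow_of_exponent_le hp1 ?_
        push_cast
        have : (p : ℝ) ≤ p * Real.log p := le_mul_of_one_le_right (by positivity) hlog1
        linarith
      _ ≤ _ := by linarith

end RAM

theorem theorem5 :
    ∃ (P : RAM.Program) (C a b : ℕ), ∀ I : ICFDInstance,
      (∀ ω : ℕ → Bool, RAM.HaltsWithin P I.encode ω
        (C * Real.exp I.p * (I.p : ℝ) ^ (a * (I.p * Real.log I.p)) * (I.m : ℝ) ^ b)) ∧
      (I.IsYesPROP → 1 - 1 / Real.exp 1 ≤ RAM.acceptProb P I.encode) ∧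
      (¬ I.IsYesPROP → RAM.acceptProb P I.encode = 0) := by
  obtain ⟨K, b, hK⟩ := RAM.exists_steps_le
  refine ⟨RAM.algorithm, K * 4096, 6, b, fun I => ⟨fun ω => ?_, fun hyes => ?_, fun hno => ?_⟩⟩
  · obtain ⟨t, s, hx, ht, -⟩ := RAM.reaches_algorithm I ω
    refine ⟨t, s, hx, ?_⟩
    have h1 : (t : ℝ) ≤ K * (I.m : ℝ) ^ b * (((2 * I.p) ^ (3 * I.p) : ℕ) : ℝ) := by
      exact_mod_cast ht.trans (hK I)
    have h2 := RAM.rounds_le I.p I.one_le_p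
    have h3 : (1 : ℝ) ≤ Real.exp I.p := Real.one_le_exp (by positivity)
    set X := (I.p : ℝ) ^ ((6 : ℕ) * (I.p * Real.log I.p))
    have hX : 0 ≤ X := by positivity
    calc (t : ℝ) ≤ K * (I.m : ℝ) ^ b * (4096 * X) :=
          h1.trans (mul_le_mul_of_nonneg_left h2 (by positivity))
      _ = (K * 4096 * X * (I.m : ℝ) ^ b) * 1 := by ring
      _ ≤ (K * 4096 * X * (I.m : ℝ) ^ b) * Real.exp I.p :=
          mul_le_mul_of_nonneg_left h3 (by positivity)
      _ = _ := by push_cast; ring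
  · have hnp : I.n ≤ I.p := by
      obtain ⟨π, hπ, -⟩ := hyes
      exact hπ.n_le_p
    refine (RAM.le_coinMeasure_exists_round I hyes rfl).trans
      (MeasureTheory.measureReal_mono fun ω hω => ?_)
    refine (RAM.reaches_algorithm I ω).accepts_iff.2 ?_
    rw [if_pos hnp]
    exact (RAM.Cmd.exec_rounds I ω (RAM.globals I) rfl rfl rfl rfl rfl le_rfl).2 hω
  · have hempty : {ω | RAM.Accepts RAM.algorithm I.encode ω} = ∅ := by
      refine Set.eq_empty_of_forall_notMem fun ω hω => hno ?_
      have hne := (RAM.reaches_algorithm I ω).accepts_iff.1 hω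
      split_ifs at hne with hnp
      · obtain ⟨c, μ, hμ, hpass⟩ :=
          (RAM.Cmd.exec_rounds I ω (RAM.globals I) rfl rfl rfl rfl rfl le_rfl).1 hne
        exact hpass.isYesPROP hnp le_rfl hμ.p_le hμ.table
      · exact absurd rfl hne
    rw [RAM.acceptProb, hempty, MeasureTheory.measureReal_empty]
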